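/- There are a deterministic word-RAM algorithm and constants $c,C,D$ with the following property. Let $n\ge 1$ and let $x$ be a string of length $n$, with positions $0,\dots,n-1$, over an arbitrary alphabet whose symbols the algorithm can access only through equality tests "is the symbol at position $i$ equal to the symbol at position $j$?" (a general unordered alphabet). For positions $i,j$ let $\mathrm{LCE}(i,j)$ be the largest $\ell$ such that $i+\ell\le n$, $j+\ell\le n$ and the length-$\ell$ factors of $x$ starting at positions $i$ and $j$ are equal. Given $n$, the algorithm may first preprocess $x$; then it is given any finite sequence of queries $(i,j)$ one by one (on-line; the number of queries is not known in advance) and returns $\mathrm{LCE}(i,j)$ for each query before the next one is revealed. If $q\ge 0$ is the number of queries, the total time, including preprocessing, is at most $$C\,\bigl(q\,(1+\log_2 n)+n\,(1+\log^* n)\bigr)$$ (that is, $\mathcal O(q\log n+n\log^* n)$ for $n\ge 2$), and the total number of equality tests is at most $D\,(n+q)$. Here $\log^* n$ is the least number of times that $\log_2$ has to be applied to $n$ until the result is at most $1$. Time is the number of steps of a unit-cost RAM with zero-initialized memory of $b$-bit words, for any word length $b\ge c\,(\lfloor\log_2 n\rfloor+1)$. Its unit-cost instructions are loading a constant, addition,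 cut-off subtraction, multiplication, integer division and remainder, comparison of machine words, memory reads and writes at computed addresses, equality tests of two symbols, and the branching tests of conditionals and loops. One and the same algorithm works for all $n$, $b$, $x$ and all query sequences. -/

import Mathlib

namespace LCE

/-! Words and longest common extensions. Positions of a word of length `n` are `0, …, n - 1`. -/

/-- The factors of length `l` of `x` starting at positions `i` and `j` exist and are equal. -/
def IsCommonExt {A : Type*} (x : List A) (i j l : ℕ) : Prop :=
  i + l ≤ x.length ∧ j + l ≤ x.length ∧ ∀ d < l, x[i + d]? = x[j + d]?

/-- `LCE(i, j)`: the length of the longest common factor starting at positions `i` and `j`. -/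
noncomputable def lce {A : Type*} (x : List A) (i j : ℕ) : ℕ :=
  sSup {l | IsCommonExt x i j l}

/-- The supremum in the definition of `lce` is a maximum. -/
theorem isGreatest_lce {A : Type*} (x : List A) {i j : ℕ} (hi : i ≤ x.length)
    (hj : j ≤ x.length) : IsGreatest {l | IsCommonExt x i j l} (lce x i j) := by
  have hne : {l | IsCommonExt x i j l}.Nonempty :=
    ⟨0, by simpa using hi, by simpa using hj, fun d hd => absurd hd (Nat.not_lt_zero d)⟩
  have hb : BddAbove {l | IsCommonExt x i j l} :=
    ⟨x.length, fun l hl => le_trans (Nat.le_add_left l i) hl.1⟩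
  exact ⟨Nat.sSup_mem hne hb, fun l hl => le_csSup hb hl⟩

/-- The iterated logarithm: the least number of times that the binary logarithm has to be
applied to `n` until the result is at most `1`. -/
noncomputable def logStar (n : ℕ) : ℕ :=
  sInf {k : ℕ | (Real.logb 2)^[k] (n : ℝ) ≤ 1}

/-! The machine: a word RAM whose only access to the word is an equality test of two positions.
It has integer registers and an integer memory, both holding `b`-bit words. -/

/-- Arithmetic and comparison instructions on machine words. -/
inductive Op where
  | add | sub | mul | div | mod | lt | eq

/-- The value computed by an instruction on `b`-bit words: results are reduced modulo `2 ^ b`,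
subtraction is cut off at `0`, division by `0` gives `0`, and a comparison gives `1` or `0`. -/
def Op.eval (b : ℕ) : Op → ℕ → ℕ → ℕ
  | .add, u, v => (u + v) % 2 ^ b
  | .sub, u, v => (u - v) % 2 ^ b
  | .mul, u, v => (u * v) % 2 ^ b
  | .div, u, v => (u / v) % 2 ^ b
  | .mod, u, v => (u % v) % 2 ^ b
  | .lt, u, v => (if u < v then 1 else 0) % 2 ^ b
  | .eq, u, v => (if u = v then 1 else 0) % 2 ^ b

/-- Programs. The numbers `r`, `s`, `t` are names of registers. -/
inductive Prog where
  /-- do nothing -/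
  | skip : Prog
  /-- `r := c` -/
  | const (r c : ℕ) : Prog
  /-- `r := s op t` -/
  | op (o : Op) (r s t : ℕ) : Prog
  /-- `r := memory[s]` -/
  | load (r s : ℕ) : Prog
  /-- `memory[r] := s` -/
  | store (r s : ℕ) : Prog
  /-- `r := 1` if the symbols at the positions held by `s` and `t` are equal, else `r := 0` -/
  | eqTest (r s t : ℕ) : Prog
  /-- `p`, then `p'` -/
  | seq (p p' : Prog) : Prog
  /-- if `r ≠ 0` then `p`, else `p'` -/
  | ite (r : ℕ) (p p' : Prog) : Prog
  /-- while `r ≠ 0` do `p` -/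
  | loop (r : ℕ) (p : Prog) : Prog

/-- A state of the machine. -/
@[ext]
structure State where
  /-- contents of the registers -/
  reg : ℕ → ℕ
  /-- contents of the memory cells -/
  mem : ℕ → ℕ

/-- Write `v` into register `r`. -/
def State.setReg (σ : State) (r v : ℕ) : State :=
  { σ with reg := Function.update σ.reg r v }

/-- Write `v` into memory cell `a`. -/
def State.setMem (σ : State) (a v : ℕ) : State :=
  { σ with mem := Function.update σ.mem a v }

open Classical in
/-- The outcome of an equality test; a test that leaves the word fails. -/
noncomputable def symEq {A : Type*} (x : List A) (i j : ℕ) : ℕ :=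
  if i < x.length ∧ j < x.length ∧ x[i]? = x[j]? then 1 else 0

/-- `Exec x b p σ time tests σ'`: on the word `x` and with `b`-bit machine words, the program `p`,
started in state `σ`, halts in state `σ'` after `time` steps, of which `tests` are equality tests.
Each elementary instruction and each evaluation of the condition of a conditional or of a loop
is one step. The machine is deterministic: the rule that applies is given by the program and
the state. -/
inductive Exec {A : Type*} (x : List A) (b : ℕ) :
    Prog → State → ℕ → ℕ → State → Prop where
  | skip (σ : State) : Exec x b .skip σ 0 0 σ
  | const (r c : ℕ) (σ : State) :
      Exec x b (.const r c) σ 1 0 (σ.setReg r (c % 2 ^ b))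
  | op (o : Op) (r s t : ℕ) (σ : State) :
      Exec x b (.op o r s t) σ 1 0 (σ.setReg r (o.eval b (σ.reg s) (σ.reg t)))
  | load (r s : ℕ) (σ : State) :
      Exec x b (.load r s) σ 1 0 (σ.setReg r (σ.mem (σ.reg s)))
  | store (r s : ℕ) (σ : State) :
      Exec x b (.store r s) σ 1 0 (σ.setMem (σ.reg r) (σ.reg s))
  | eqTest (r s t : ℕ) (σ : State) :
      Exec x b (.eqTest r s t) σ 1 1 (σ.setReg r (symEq x (σ.reg s) (σ.reg t)))
  | seq {p p' : Prog} {σ σ' σ'' : State} {k k' e e' : ℕ} :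
      Exec x b p σ k e σ' → Exec x b p' σ' k' e' σ'' →
      Exec x b (.seq p p') σ (k + k') (e + e') σ''
  | iteTrue {r : ℕ} {p p' : Prog} {σ σ' : State} {k e : ℕ} :
      σ.reg r ≠ 0 → Exec x b p σ k e σ' → Exec x b (.ite r p p') σ (k + 1) e σ'
  | iteFalse {r : ℕ} {p p' : Prog} {σ σ' : State} {k e : ℕ} :
      σ.reg r = 0 → Exec x b p' σ k e σ' → Exec x b (.ite r p p') σ (k + 1) e σ'
  | loopDone {r : ℕ} {p : Prog} {σ : State} :
      σ.reg r = 0 → Exec x b (.loop r p) σ 1 0 σ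
  | loopStep {r : ℕ} {p : Prog} {σ σ' σ'' : State} {k k' e e' : ℕ} :
      σ.reg r ≠ 0 → Exec x b p σ k e σ' → Exec x b (.loop r p) σ' k' e' σ'' →
      Exec x b (.loop r p) σ (k + k' + 1) (e + e') σ''

/-- The initial state for a word of length `n`: register `0` holds `n`, and all other registers
and all memory cells hold `0`. -/
def State.init (n : ℕ) : State :=
  (State.mk (fun _ => 0) (fun _ => 0)).setReg 0 n

/-- `Answers x b p σ qs as time tests`: from the state `σ`, the queries `qs` are handed over
one by one to the program `p`, and it returns the answers `as`, using `time` steps and `tests`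
equality tests in total. A query `(i, j)` is passed in the registers `0` and `1`, and its answer is
read from register `0` before the next query is revealed; the rest of the state is kept from one
query to the next. -/
inductive Answers {A : Type*} (x : List A) (b : ℕ) (p : Prog) :
    State → List (ℕ × ℕ) → List ℕ → ℕ → ℕ → Prop where
  | nil (σ : State) : Answers x b p σ [] [] 0 0
  | cons {σ σ' : State} {i j : ℕ} {qs : List (ℕ × ℕ)} {as : List ℕ} {k k' e e' : ℕ} :
      Exec x b p ((σ.setReg 0 i).setReg 1 j) k e σ' →
      Answers x b p σ' qs as k' e' →
      Answers x b p σ ((i, j) :: qs) (σ'.reg 0 :: as) (k + k') (e + e')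

end LCE

namespace LCE

/-! Weakest preconditions of programs. -/

/-! A block of level `k` is a factor of length `4 ^ k` at a position whose lowest `k` base-4 digits
all lie in {0, 2} or all lie in {0, 1}. Level `k` has O(n / 2 ^ k) blocks (`card_levelSet`), so
there are O(n) in all. For given `i` and `j`, the offsets `d` such that `i + d` has even digits and
`j + d` has low digits form one class modulo `4 ^ k`; hence, from some small offset on, both
suffixes are cut simultaneously into blocks of level `k`.

Blocks known to be equal are kept in union-find classes, separately for each level. A query extends
the common offset `d`. Two blocks in one class are skipped; otherwise the query descends to their
four sub-blocks, and at level 0 it compares symbols. When `d` is synchronized at the next level and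
at least `4 ^ (k + 1)`, the last `4 ^ (k + 1)` matched symbols are a pair of equal blocks one level
up: these are linked, and the query continues at that level.

A successful symbol test merges two classes of level 0 and a failed one ends its query, so at most
`n + 1 + q` tests occur. For time, let `a k` bound the amortized cost of an iteration at level `k`.
A descent into blocks that prove equal ends in a link, whose potential drop pays for it
(`Finishes.block`); the rest is a bounded number of iterations per level (`Finishes.climb`), so a
query costs O(∑ a k).

Finds use linking by rank and path halving, analysed with buckets of ranks. Low levels, `2 ^ k <
(log n) ^ 2`, use tower buckets: each block needs initial credit O(log* n), a find costs O(log* n),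
and there are only O(log log n) such levels. Higher levels use a single bucket: finds are O(1), and
a credit of O(log n) per block is affordable because these levels have few blocks. Thus ∑ a k is
O(log n) (`sum_iterCost_le`) while the initial potential is O(n log* n) (`timePot_zero_le`). -/

/-- The program halts from `σ`, and time, number of tests and final state satisfy `Q`. -/
def wp {A : Type*} (x : List A) (b : ℕ) (p : Prog) (σ : State)
    (Q : ℕ → ℕ → State → Prop) : Prop :=
  ∃ t e σ', Exec x b p σ t e σ' ∧ Q t e σ'

section wp
variable {A : Type*} {x : List A} {b : ℕ} {σ : State} {Q Q' : ℕ → ℕ → State → Prop}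

theorem wp.mono {p : Prog} (h : wp x b p σ Q) (hQ : ∀ t e σ', Q t e σ' → Q' t e σ') :
    wp x b p σ Q' := by
  obtain ⟨t, e, σ', h1, h2⟩ := h
  exact ⟨t, e, σ', h1, hQ _ _ _ h2⟩

@[simp] theorem wp_skip : wp x b .skip σ Q ↔ Q 0 0 σ := by
  constructor
  · rintro ⟨t, e, σ', h1, h2⟩; cases h1; exact h2
  · exact fun h => ⟨_, _, _, .skip _, h⟩

@[simp] theorem wp_const {r c : ℕ} : wp x b (.const r c) σ Q ↔ Q 1 0 (σ.setReg r (c % 2 ^ b)) := by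
  constructor
  · rintro ⟨t, e, σ', h1, h2⟩; cases h1; exact h2
  · exact fun h => ⟨_, _, _, .const _ _ _, h⟩

@[simp] theorem wp_op {o : Op} {r s t : ℕ} :
    wp x b (.op o r s t) σ Q ↔ Q 1 0 (σ.setReg r (o.eval b (σ.reg s) (σ.reg t))) := by
  constructor
  · rintro ⟨t, e, σ', h1, h2⟩; cases h1; exact h2
  · exact fun h => ⟨_, _, _, .op _ _ _ _ _, h⟩

@[simp] theorem wp_load {r s : ℕ} :
    wp x b (.load r s) σ Q ↔ Q 1 0 (σ.setReg r (σ.mem (σ.reg s))) := by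
  constructor
  · rintro ⟨t, e, σ', h1, h2⟩; cases h1; exact h2
  · exact fun h => ⟨_, _, _, .load _ _ _, h⟩

@[simp] theorem wp_store {r s : ℕ} :
    wp x b (.store r s) σ Q ↔ Q 1 0 (σ.setMem (σ.reg r) (σ.reg s)) := by
  constructor
  · rintro ⟨t, e, σ', h1, h2⟩; cases h1; exact h2
  · exact fun h => ⟨_, _, _, .store _ _ _, h⟩

@[simp] theorem wp_eqTest {r s t : ℕ} :
    wp x b (.eqTest r s t) σ Q ↔ Q 1 1 (σ.setReg r (symEq x (σ.reg s) (σ.reg t))) := by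
  constructor
  · rintro ⟨t, e, σ', h1, h2⟩; cases h1; exact h2
  · exact fun h => ⟨_, _, _, .eqTest _ _ _ _, h⟩

@[simp] theorem wp_seq {p p' : Prog} : wp x b (.seq p p') σ Q ↔
    wp x b p σ fun t e σ' => wp x b p' σ' fun t' e' σ'' => Q (t + t') (e + e') σ'' := by
  constructor
  · rintro ⟨t, e, σ', h1, h2⟩
    cases h1 with
    | seq h3 h4 => exact ⟨_, _, _, h3, _, _, _, h4, h2⟩
  · rintro ⟨t, e, σ', h1, t', e', σ'', h2, h3⟩
    exact ⟨_, _, _, .seq h1 h2, h3⟩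

@[simp] theorem wp_ite {r : ℕ} {p p' : Prog} : wp x b (.ite r p p') σ Q ↔
    if σ.reg r = 0 then wp x b p' σ fun t e σ' => Q (t + 1) e σ'
    else wp x b p σ fun t e σ' => Q (t + 1) e σ' := by
  constructor
  · rintro ⟨t, e, σ', h1, h2⟩
    cases h1 with
    | iteTrue h3 h4 => rw [if_neg h3]; exact ⟨_, _, _, h4, h2⟩
    | iteFalse h3 h4 => rw [if_pos h3]; exact ⟨_, _, _, h4, h2⟩
  · split_ifs with h
    · rintro ⟨t, e, σ', h1, h2⟩; exact ⟨_, _, _, .iteFalse h h1, h2⟩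
    · rintro ⟨t, e, σ', h1, h2⟩; exact ⟨_, _, _, .iteTrue h h1, h2⟩

theorem wp_loop_done {r : ℕ} {p : Prog} (h : σ.reg r = 0) (hQ : Q 1 0 σ) :
    wp x b (.loop r p) σ Q := ⟨_, _, _, .loopDone h, hQ⟩

theorem wp_loop_step {r : ℕ} {p : Prog} (h : σ.reg r ≠ 0)
    (hQ : wp x b p σ fun t e σ' => wp x b (.loop r p) σ' fun t' e' σ'' =>
      Q (t + t' + 1) (e + e') σ'') :
    wp x b (.loop r p) σ Q := by
  obtain ⟨t, e, σ', h1, t', e', σ'', h2, h3⟩ := hQ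
  exact ⟨_, _, _, .loopStep h h1 h2, h3⟩

@[simp] theorem State.setReg_reg (σ : State) (r v s : ℕ) :
    (σ.setReg r v).reg s = if s = r then v else σ.reg s := by
  simp [State.setReg, Function.update_apply]

@[simp] theorem State.setReg_mem (σ : State) (r v : ℕ) : (σ.setReg r v).mem = σ.mem := rfl

@[simp] theorem State.setMem_reg (σ : State) (a v : ℕ) : (σ.setMem a v).reg = σ.reg := rfl

@[simp] theorem State.setMem_mem (σ : State) (a v : ℕ) :
    (σ.setMem a v).mem = Function.update σ.mem a v := rfl

end wp

end LCE

namespace LCE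

/-! Union-find forests and their potentials. -/

/-- The memory `m` holds a forest on the set `U` of addresses: the cell `a` holds the parent of `a`,
or `0` if `a` is a root, and the cell `a + 1` holds the rank of `a`. The root of the tree of `a` is
`rep a`, and trees do not cross the levels `lev`. -/
structure Forest (U : Finset ℕ) (lev m rep : ℕ → ℕ) : Prop where
  even : ∀ a ∈ U, Even a
  par : ∀ a ∈ U, m a ≠ 0 → m a ∈ U ∧ lev (m a) = lev a ∧ m (a + 1) < m (m a + 1) ∧
    rep (m a) = rep a
  root : ∀ a ∈ U, m a = 0 → rep a = a
  rep : ∀ a ∈ U, rep a ∈ U ∧ m (rep a) = 0 ∧ lev (rep a) = lev a ∧ m (a + 1) ≤ m (rep a + 1)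

/-- A potential of a forest: a root of rank `r` in level `l` counts `ρ l r`, any other element of
rank `r` with a parent of rank `s` counts `χ l r s`. -/
noncomputable def pot (U : Finset ℕ) (lev : ℕ → ℕ) (ρ : ℕ → ℕ → ℝ) (χ : ℕ → ℕ → ℕ → ℝ)
    (m : ℕ → ℕ) : ℝ :=
  ∑ a ∈ U, if m a = 0 then ρ (lev a) (m (a + 1)) else χ (lev a) (m (a + 1)) (m (m a + 1))

/-- Potentials that drop by at least `g l` when two roots of level `l` of ranks at most `N` are
linked by rank, and that do not grow when a node is moved to a parent of larger rank. -/
structure Weights (N : ℕ) (ρ : ℕ → ℕ → ℝ) (χ : ℕ → ℕ → ℕ → ℝ) (g : ℕ → ℝ) : Prop where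
  anti : ∀ l r s s', s ≤ s' → χ l r s' ≤ χ l r s
  lt : ∀ l r s, r < s → s ≤ N → χ l r s + g l ≤ ρ l r
  eq : ∀ l r, r ≤ N → ρ l (r + 1) + χ l r (r + 1) + g l ≤ 2 * ρ l r
  nonneg_root : ∀ l r, 0 ≤ ρ l r
  nonneg : ∀ l r s, 0 ≤ χ l r s

variable {U : Finset ℕ} {lev m rep : ℕ → ℕ} {ρ : ℕ → ℕ → ℝ} {χ : ℕ → ℕ → ℕ → ℝ}
  {g : ℕ → ℝ} {N : ℕ}

theorem Weights.pot_nonneg (hw : Weights N ρ χ g) : 0 ≤ pot U lev ρ χ m := by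
  refine Finset.sum_nonneg fun a _ => ?_
  split_ifs
  · exact hw.nonneg_root _ _
  · exact hw.nonneg _ _ _

/-- Moving a node to its grandparent. -/
theorem Forest.halve (h : Forest U lev m rep) {a : ℕ} (ha : a ∈ U) (h1 : m a ≠ 0)
    (h2 : m (m a) ≠ 0) : Forest U lev (Function.update m a (m (m a))) rep := by
  obtain ⟨ha1, hl1, hr1, he1⟩ := h.par a ha h1
  obtain ⟨ha2, hl2, hr2, he2⟩ := h.par _ ha1 h2
  -- Parent cells have even addresses and rank cells odd ones, so ranks are untouched.
  have hrk : ∀ c ∈ U, Function.update m a (m (m a)) (c + 1) = m (c + 1) := by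
    intro c hc
    refine Function.update_of_ne ?_ _ _
    have := h.even a ha; have := h.even c hc; grind
  refine ⟨h.even, ?_, ?_, ?_⟩
  · intro c hc hc0
    by_cases hca : c = a
    · subst hca
      rw [hrk c hc, Function.update_self, hrk _ ha2]
      exact ⟨ha2, by omega, by omega, by rw [he2, he1]⟩
    · rw [Function.update_of_ne hca] at hc0 ⊢
      have := h.par c hc hc0
      rw [hrk c hc, hrk _ this.1]
      exact this
  · intro c hc hc0
    by_cases hca : c = a
    · subst hca
      rw [Function.update_self] at hc0
      exact absurd hc0 h2
    · rw [Function.update_of_ne hca] at hc0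
      exact h.root c hc hc0
  · intro c hc
    have := h.rep c hc
    rw [hrk c hc, hrk _ this.1]
    have hne : rep c ≠ a := by
      intro e
      rw [e] at this
      exact h1 this.2.1
    rw [Function.update_of_ne hne]
    exact this

/-- Halving changes no rank and no root, so only the summand of `a` changes. -/
theorem Forest.pot_halve (h : Forest U lev m rep) {a : ℕ} (ha : a ∈ U) (h1 : m a ≠ 0)
    (h2 : m (m a) ≠ 0) :
    pot U lev ρ χ (Function.update m a (m (m a))) = pot U lev ρ χ m -
      χ (lev a) (m (a + 1)) (m (m a + 1)) + χ (lev a) (m (a + 1)) (m (m (m a) + 1)) := by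
  obtain ⟨ha1, hl1, hr1, he1⟩ := h.par a ha h1
  obtain ⟨ha2, hl2, hr2, he2⟩ := h.par _ ha1 h2
  have hrk : ∀ c ∈ U, Function.update m a (m (m a)) (c + 1) = m (c + 1) := by
    intro c hc
    refine Function.update_of_ne ?_ _ _
    have := h.even a ha; have := h.even c hc; grind
  unfold pot
  rw [← Finset.add_sum_erase U _ ha, ← Finset.add_sum_erase U _ ha]
  rw [Function.update_self, if_neg h2, if_neg h1, hrk a ha, hrk _ ha2]
  have : ∀ c ∈ U.erase a, (if Function.update m a (m (m a)) c = 0 then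
      ρ (lev c) (Function.update m a (m (m a)) (c + 1)) else
      χ (lev c) (Function.update m a (m (m a)) (c + 1))
        (Function.update m a (m (m a)) (Function.update m a (m (m a)) c + 1))) =
      if m c = 0 then ρ (lev c) (m (c + 1)) else χ (lev c) (m (c + 1)) (m (m c + 1)) := by
    intro c hc
    obtain ⟨hca, hc⟩ := Finset.mem_erase.1 hc
    rw [Function.update_of_ne hca, hrk c hc]
    split_ifs with h0
    · rfl
    · rw [hrk _ (h.par c hc h0).1]
  rw [Finset.sum_congr rfl this]
  ring

/-- The memory after the root `c` has been made a child of the root `r`, which gets rank `s`. -/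
def attach (m : ℕ → ℕ) (c r s : ℕ) : ℕ → ℕ :=
  Function.update (Function.update m c r) (r + 1) s

theorem attach_par (he : ∀ a ∈ U, Even a) {c r s a : ℕ} (hr : r ∈ U)
    (ha : a ∈ U) : attach m c r s a = if a = c then r else m a := by
  have := he r hr; have := he a ha
  unfold attach
  rw [Function.update_of_ne (by grind), Function.update_apply]

theorem attach_rank (he : ∀ a ∈ U, Even a) {c r s a : ℕ} (hc : c ∈ U)
    (ha : a ∈ U) : attach m c r s (a + 1) = if a = r then s else m (a + 1) := by
  have := he c hc; have := he a ha
  unfold attach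
  rw [Function.update_apply, Function.update_of_ne (by grind)]
  simp

theorem Forest.attach (h : Forest U lev m rep) {c r s : ℕ} (hc : c ∈ U) (hr : r ∈ U)
    (mc : m c = 0) (mr : m r = 0) (hne : c ≠ r) (hl : lev c = lev r) (r0 : r ≠ 0)
    (hs : m (r + 1) ≤ s) (hcs : m (c + 1) < s) :
    Forest U lev (LCE.attach m c r s) fun a => if rep a = c then r else rep a := by
  have hp : ∀ a ∈ U, LCE.attach m c r s a = if a = c then r else m a := fun a ha =>
    attach_par h.even hr ha
  have hk : ∀ a ∈ U, LCE.attach m c r s (a + 1) = if a = r then s else m (a + 1) := fun a ha =>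
    attach_rank h.even hc ha
  refine ⟨h.even, ?_, ?_, ?_⟩
  · intro a ha ha0
    rw [hp a ha] at ha0 ⊢
    rw [hk a ha]
    by_cases hac : a = c
    · subst hac
      simp only [if_true, if_neg hne]
      rw [hk r hr, if_pos rfl, h.root _ hr mr, h.root _ ha mc]
      simp [hr, hl, hcs]
    · rw [if_neg hac] at ha0 ⊢
      obtain ⟨q1, q2, q3, q4⟩ := h.par a ha ha0
      rw [hk _ q1, q4]
      have : a ≠ r := by rintro rfl; exact ha0 mr
      rw [if_neg this]
      refine ⟨q1, q2, ?_, rfl⟩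
      split_ifs with e
      · rw [e] at q3; omega
      · exact q3
  · intro a ha ha0
    rw [hp a ha] at ha0
    split_ifs at ha0 with hac
    · exact absurd ha0 r0
    · rw [h.root a ha ha0, if_neg hac]
  · intro a ha
    obtain ⟨q1, q2, q3, q4⟩ := h.rep a ha
    rw [hk a ha]
    by_cases hac : rep a = c
    · rw [if_pos hac, hp r hr, hk r hr, if_neg hne.symm, if_pos rfl]
      rw [hac] at q3 q4
      refine ⟨hr, mr, by omega, ?_⟩
      split_ifs <;> omega
    · rw [if_neg hac, hp _ q1, if_neg hac, hk _ q1]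
      refine ⟨q1, q2, q3, ?_⟩
      by_cases har : a = r
      · subst har
        rw [if_pos rfl, if_pos (h.root _ ha mr)]
      · rw [if_neg har]
        split_ifs with e
        · rw [e] at q4; omega
        · exact q4

/-- Apart from `c` and `r`, only children of `r` are affected: they may see a larger parent rank,
which is harmless by `anti`. The two link inequalities of `Weights` handle `c` and `r`. -/
theorem Forest.pot_attach (h : Forest U lev m rep) (hw : Weights N ρ χ g) {c r s : ℕ}
    (hc : c ∈ U) (hr : r ∈ U) (mc : m c = 0) (mr : m r = 0) (hne : c ≠ r) (hl : lev c = lev r)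
    (r0 : r ≠ 0) (hN : m (r + 1) ≤ N)
    (hs : m (c + 1) < m (r + 1) ∧ s = m (r + 1) ∨ m (c + 1) = m (r + 1) ∧ s = m (r + 1) + 1) :
    pot U lev ρ χ (LCE.attach m c r s) + g (lev c) ≤ pot U lev ρ χ m := by
  have hp : ∀ a ∈ U, LCE.attach m c r s a = if a = c then r else m a := fun a ha =>
    attach_par h.even hr ha
  have hk : ∀ a ∈ U, LCE.attach m c r s (a + 1) = if a = r then s else m (a + 1) := fun a ha =>
    attach_rank h.even hc ha
  have hr' : r ∈ U.erase c := Finset.mem_erase.2 ⟨hne.symm, hr⟩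
  unfold pot
  rw [← Finset.add_sum_erase U _ hc, ← Finset.add_sum_erase U _ hc,
    ← Finset.add_sum_erase _ _ hr', ← Finset.add_sum_erase _ _ hr', hp c hc, hp r hr,
    hk c hc, hk r hr]
  simp only [if_true, if_neg hne, if_neg hne.symm, if_neg r0, mc, mr, hk r hr]
  have h1 : ∀ a ∈ (U.erase c).erase r, (if LCE.attach m c r s a = 0 then
      ρ (lev a) (LCE.attach m c r s (a + 1)) else
      χ (lev a) (LCE.attach m c r s (a + 1)) (LCE.attach m c r s (LCE.attach m c r s a + 1))) ≤
      if m a = 0 then ρ (lev a) (m (a + 1)) else χ (lev a) (m (a + 1)) (m (m a + 1)) := by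
    intro a ha
    obtain ⟨har, hac, ha⟩ := by simpa only [Finset.mem_erase] using ha
    rw [hp a ha, hk a ha, if_neg hac, if_neg har]
    split_ifs with h0
    · rfl
    · rw [hk _ (h.par a ha h0).1]
      split_ifs with e
      · apply hw.anti
        rw [e]; omega
      · rfl
  have h2 := Finset.sum_le_sum h1
  have h3 : χ (lev c) (m (c + 1)) s + ρ (lev r) s + g (lev c) ≤
      ρ (lev c) (m (c + 1)) + ρ (lev r) (m (r + 1)) := by
    rw [hl]
    rcases hs with ⟨q1, q2⟩ | ⟨q1, q2⟩
    · rw [q2]; linarith [hw.lt (lev r) _ _ q1 hN]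
    · rw [q2, q1]; linarith [hw.eq (lev r) _ hN]
  linarith

/-! ### Rank bounds and linking by rank. -/

/-- The potential bounding ranks: `2 ^ r` for each root of rank `r` in level `k`. -/
def rankWeight (k l r : ℕ) : ℝ := if l = k then 2 ^ r else 0

theorem weights_rank (k N : ℕ) :
    Weights N (rankWeight k) (fun _ _ _ => 0) fun _ => 0 where
  anti := by simp
  lt := by intros; unfold rankWeight; split_ifs <;> simp
  eq := by intros; unfold rankWeight; split_ifs <;> simp [pow_succ, mul_comm]
  nonneg_root := by intros; unfold rankWeight; split_ifs <;> simp
  nonneg := by simp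

/-- A forest in which the number of elements of each level bounds the ranks. -/
structure RankedForest (M : ℕ) (U : Finset ℕ) (lev m rep : ℕ → ℕ) : Prop
    extends Forest U lev m rep where
  sum_rank : ∀ k, pot U lev (rankWeight k) (fun _ _ _ => 0) m ≤ M

/-- Ranks do not exceed that of the root, and a root of rank `r` alone contributes `2 ^ r` to a sum
bounded by `M`. -/
theorem RankedForest.rank_le {M : ℕ} (h : RankedForest M U lev m rep) {a : ℕ} (ha : a ∈ U) :
    m (a + 1) ≤ Nat.log 2 M := by
  obtain ⟨q1, q2, q3, q4⟩ := h.rep a ha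
  refine q4.trans ?_
  have h1 := h.sum_rank (lev (rep a))
  unfold pot at h1
  have h2 := Finset.single_le_sum (f := fun c => if m c = 0 then
    rankWeight (lev (rep a)) (lev c) (m (c + 1)) else (0 : ℝ)) (fun c _ => by
      split_ifs
      · exact (weights_rank _ 0).nonneg_root _ _
      · rfl) q1
  simp only [q2, if_true, rankWeight] at h2
  have h3 : (2 : ℝ) ^ m (rep a + 1) ≤ M := by
    simp only [rankWeight] at h1
    linarith
  have h4 : 2 ^ m (rep a + 1) ≤ M := by exact_mod_cast h3
  exact Nat.le_log_of_pow_le (by norm_num) h4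

theorem RankedForest.halve {M : ℕ} (h : RankedForest M U lev m rep) {a : ℕ} (ha : a ∈ U)
    (h1 : m a ≠ 0) (h2 : m (m a) ≠ 0) :
    RankedForest M U lev (Function.update m a (m (m a))) rep :=
  { h.toForest.halve ha h1 h2 with
    sum_rank := fun k => by
      rw [h.toForest.pot_halve ha h1 h2]
      simpa using h.sum_rank k }

theorem RankedForest.attach {M : ℕ} (h : RankedForest M U lev m rep) {c r s : ℕ} (hc : c ∈ U)
    (hr : r ∈ U) (mc : m c = 0) (mr : m r = 0) (hne : c ≠ r) (hl : lev c = lev r) (r0 : r ≠ 0)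
    (hs : m (c + 1) < m (r + 1) ∧ s = m (r + 1) ∨ m (c + 1) = m (r + 1) ∧ s = m (r + 1) + 1) :
    RankedForest M U lev (LCE.attach m c r s) fun a => if rep a = c then r else rep a :=
  { h.toForest.attach hc hr mc mr hne hl r0 (by omega) (by omega) with
    sum_rank := fun k => by
      have := h.toForest.pot_attach (weights_rank k (Nat.log 2 M)) hc hr mc mr hne hl r0
        (h.rank_le hr) hs
      linarith [h.sum_rank k] }

/-- The memory after two roots have been linked by rank. -/
def link (m : ℕ → ℕ) (u v : ℕ) : ℕ → ℕ :=
  if m (u + 1) < m (v + 1) then attach m u v (m (v + 1))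
  else attach m v u (if m (u + 1) = m (v + 1) then m (u + 1) + 1 else m (u + 1))

/-- Hides which of the two roots survives: the merged class is represented by `u` or `v`, and all
other classes keep their representatives. -/
theorem RankedForest.link {M : ℕ} (h : RankedForest M U lev m rep) {u v : ℕ} (hu : u ∈ U)
    (hv : v ∈ U) (mu : m u = 0) (mv : m v = 0) (hne : u ≠ v) (hl : lev u = lev v) (u0 : u ≠ 0)
    (v0 : v ≠ 0) :
    ∃ rep', RankedForest M U lev (LCE.link m u v) rep' ∧
      (∀ ρ χ g, Weights (Nat.log 2 M) ρ χ g →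
        pot U lev ρ χ (LCE.link m u v) + g (lev u) ≤ pot U lev ρ χ m) ∧
      (∀ a, rep a ≠ u → rep a ≠ v → rep' a = rep a) ∧
      (∀ a, rep a = u ∨ rep a = v → rep' a = u ∨ rep' a = v) ∧
      (∀ a c, rep a = u → rep c = v → rep' a = rep' c) := by
  unfold LCE.link
  split_ifs with h1 h2
  · refine ⟨_, h.attach hu hv mu mv hne hl v0 (Or.inl ⟨h1, rfl⟩), fun ρ χ g hw =>
      h.toForest.pot_attach hw hu hv mu mv hne hl v0 (h.rank_le hv) (Or.inl ⟨h1, rfl⟩), ?_, ?_, ?_⟩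
    · intro a ha _; simp [ha]
    · intro a ha; rcases ha with ha | ha <;> simp [ha]
    · intro a c ha hc; simp [ha, hc]
  all_goals
    have hs : m (v + 1) < m (u + 1) ∨ m (v + 1) = m (u + 1) := by omega
  · refine ⟨_, h.attach hv hu mv mu hne.symm hl.symm u0 (Or.inr ⟨h2.symm, rfl⟩), fun ρ χ g hw =>
      hl ▸ h.toForest.pot_attach hw hv hu mv mu hne.symm hl.symm u0 (h.rank_le hu)
        (Or.inr ⟨h2.symm, rfl⟩), ?_, ?_, ?_⟩
    · intro a _ ha; simp [ha]
    · intro a ha; rcases ha with ha | ha <;> simp [ha]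
    · intro a c ha hc; simp [ha, hc]
  · have h3 : m (v + 1) < m (u + 1) := by omega
    refine ⟨_, h.attach hv hu mv mu hne.symm hl.symm u0 (Or.inl ⟨h3, rfl⟩), fun ρ χ g hw =>
      hl ▸ h.toForest.pot_attach hw hv hu mv mu hne.symm hl.symm u0 (h.rank_le hu)
        (Or.inl ⟨h3, rfl⟩), ?_, ?_, ?_⟩
    · intro a _ ha; simp [ha]
    · intro a ha; rcases ha with ha | ha <;> simp [ha]
    · intro a c ha hc; simp [ha, hc]

end LCE

namespace LCE

/-! Union-find programs. -/

/-- Register `r` is set to the root of its tree, with path halving. Register `20` holds `0`. -/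
def findProg (r : ℕ) : Prog :=
  .seq (.load 14 r) <| .loop 14 <| .seq (.load 15 14) <| .ite 15
    (.seq (.store r 15) <| .seq (.op .add r 15 20) <| .load 14 r)
    (.seq (.op .add r 14 20) <| .const 14 0)

/-- The roots in registers `12` and `13` are linked. Register `4` holds `1`. -/
def linkProg : Prog :=
  .seq (.op .add 17 12 4) <| .seq (.op .add 18 13 4) <|
  .seq (.load 14 17) <| .seq (.load 15 18) <| .seq (.op .lt 19 14 15) <| .ite 19
    (.store 12 13)
    (.seq (.store 13 12) <| .seq (.op .eq 19 14 15) <| .ite 19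
      (.seq (.op .add 14 14 4) <| .store 17 14) .skip)

/-- Ranks are divided into buckets: when the parent of a node changes, either the potential drops
or the bucket of the parent differs from the bucket of the node. -/
structure Buckets (N : ℕ) (χ : ℕ → ℕ → ℕ → ℝ) (β : ℕ → ℕ → ℕ) (R : ℕ → ℕ) : Prop where
  step : ∀ l r s s', r < s → s < s' → s' ≤ N → χ l r s' + 1 ≤ χ l r s ∨ β l r < β l s'
  mono : ∀ l r s, r ≤ s → β l r ≤ β l s
  le : ∀ l r, r ≤ N → β l r ≤ R l

variable {U : Finset ℕ} {lev rep : ℕ → ℕ} {ρ : ℕ → ℕ → ℝ} {χ : ℕ → ℕ → ℕ → ℝ}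
  {g : ℕ → ℝ} {M b : ℕ} {β : ℕ → ℕ → ℕ} {R : ℕ → ℕ} {A : Type*} {x : List A}

/-- The outcome of a find for the element `a` of a forest. -/
structure FindSpec (M : ℕ) (U : Finset ℕ) (lev rep : ℕ → ℕ) (r a : ℕ) (σ σ' : State) :
    Prop where
  forest : RankedForest M U lev σ'.mem rep
  pot : ∀ ρ χ g, Weights (Nat.log 2 M) ρ χ g → pot U lev ρ χ σ'.mem ≤ pot U lev ρ χ σ.mem
  reg : σ'.reg r = rep a
  frame : ∀ s, s ≠ r → s ≠ 14 → s ≠ 15 → σ'.reg s = σ.reg s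

/-- A halving pass takes six steps, paid either by a unit drop in the credit of the node or by a
rise of the bucket index of the current node, which is bounded by `R`. The `+ 1` covers the last
pass. Ranks increase strictly along the path, so `k` serves as fuel. -/
theorem wp_find_loop (hb : ∀ a ∈ U, a < 2 ^ b) (hB : Buckets (Nat.log 2 M) χ β R)
    (hw : Weights (Nat.log 2 M) ρ χ g)
    {r : ℕ} (hr : r ≠ 14 ∧ r ≠ 15 ∧ r ≠ 20) (k : ℕ) : ∀ (σ : State) (a : ℕ),
    RankedForest M U lev σ.mem rep → a ∈ U → σ.reg r = a → σ.reg 14 = σ.mem a → σ.reg 20 = 0 →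
    Nat.log 2 M < σ.mem (a + 1) + k →
    wp x b (.loop 14 <| .seq (.load 15 14) <| .ite 15
      (.seq (.store r 15) <| .seq (.op .add r 15 20) <| .load 14 r)
      (.seq (.op .add r 14 20) <| .const 14 0)) σ fun t e σ' => e = 0 ∧
        (t : ℝ) + 6 * pot U lev ρ χ σ'.mem ≤ 6 * pot U lev ρ χ σ.mem +
          6 * (R (lev a) + 1 - β (lev a) (σ.mem (a + 1))) ∧
        FindSpec M U lev rep r a σ σ' := by
  obtain ⟨r1, r2, r3⟩ := hr
  induction k with
  | zero =>
    intro σ a hf ha hra h14 h20 hk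
    have := hf.rank_le ha
    omega
  | succ k ih =>
    intro σ a hf ha hra h14 h20 hk
    have hβ : (β (lev a) (σ.mem (a + 1)) : ℝ) ≤ R (lev a) := by
      exact_mod_cast hB.le _ _ (hf.rank_le ha)
    by_cases h0 : σ.mem a = 0
    · refine wp_loop_done (by rw [h14, h0]) ⟨rfl, ?_, hf, fun _ _ _ _ => le_rfl, ?_,
        fun _ _ _ _ => rfl⟩
      · push_cast; linarith
      · rw [hra, hf.root a ha h0]
    obtain ⟨q1, q2, q3, q4⟩ := hf.par a ha h0
    refine wp_loop_step (by rw [h14]; exact h0) ?_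
    simp only [wp_seq, wp_load, wp_ite, State.setReg_reg, if_true, h14]
    by_cases h1 : σ.mem (σ.mem a) = 0
    · rw [if_pos h1]
      simp only [wp_op, wp_const, State.setReg_reg, Op.eval, h14, h20]
      refine wp_loop_done (by simp [State.setReg_reg]) ?_
      refine ⟨rfl, ?_, hf, fun _ _ _ _ => le_rfl, ?_, ?_⟩
      · push_cast [State.setReg_mem]; linarith
      · have := hb _ q1
        simp [State.setReg_reg, r1, Nat.mod_eq_of_lt this]
        rw [← q4, hf.root _ q1 h1]
      · intro s s1 s2 s3; simp [State.setReg_reg, s1, s2, s3]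
    · rw [if_neg h1]
      obtain ⟨p1, p2, p3, p4⟩ := hf.par _ q1 h1
      have hlt := hb _ p1
      have hne : σ.mem (σ.mem a) ≠ a := by
        intro e; rw [e] at p3; omega
      have hN := hf.rank_le p1
      have hrk : Function.update σ.mem a (σ.mem (σ.mem a)) (σ.mem (σ.mem a) + 1) =
          σ.mem (σ.mem (σ.mem a) + 1) := by
        refine Function.update_of_ne ?_ _ _
        have := hf.even a ha; have := hf.even _ p1; grind
      simp [Op.eval, h20, r2, hra, Nat.mod_eq_of_lt hlt]
      refine (ih _ (σ.mem (σ.mem a)) (hf.halve ha h0 h1) p1 ?_ ?_ ?_ ?_).mono ?_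
      · simp [State.setReg_reg, r1]
      · simp [State.setReg_reg, State.setReg_mem, State.setMem_mem]
      · simp [State.setReg_reg, State.setMem_reg, r3.symm, h20]
      · simp only [State.setReg_mem, State.setMem_mem, hrk]; omega
      · rintro t e σ' ⟨he, ht, f1, f2, f3, f4⟩
        simp only [State.setReg_mem, State.setMem_mem, hrk] at ht f2
        have hpot := fun ρ χ => hf.toForest.pot_halve (ρ := ρ) (χ := χ) ha h0 h1
        refine ⟨by omega, ?_, f1, ?_, ?_, ?_⟩
        · rw [hpot, p2, q2] at ht
          have hanti := hw.anti (lev a) (σ.mem (a + 1)) _ _ p3.le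
          have hm : (β (lev a) (σ.mem (a + 1)) : ℝ) ≤
              β (lev a) (σ.mem (σ.mem (σ.mem a) + 1)) := by
            exact_mod_cast hB.mono _ _ _ (by omega)
          rcases hB.step (lev a) _ _ _ q3 p3 hN with h | h
          · linarith
          · have : (β (lev a) (σ.mem (a + 1)) : ℝ) + 1 ≤
              β (lev a) (σ.mem (σ.mem (σ.mem a) + 1)) := by exact_mod_cast h
            linarith
        · intro ρ' χ' g' hw'
          have := f2 ρ' χ' g' hw'
          rw [hpot] at this
          linarith [hw'.anti (lev a) (σ.mem (a + 1)) _ _ p3.le]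
        · rw [f3, p4, q4]
        · intro s s1 s2 s3
          rw [f4 s s1 s2 s3]
          simp [State.setReg_reg, State.setMem_reg, s1, s2, s3]

theorem wp_find (hb : ∀ a ∈ U, a < 2 ^ b) (hB : Buckets (Nat.log 2 M) χ β R)
    (hw : Weights (Nat.log 2 M) ρ χ g) {r : ℕ} (hr : r ≠ 14 ∧ r ≠ 15 ∧ r ≠ 20) {σ : State}
    {a : ℕ} (hf : RankedForest M U lev σ.mem rep) (ha : a ∈ U) (hra : σ.reg r = a)
    (h20 : σ.reg 20 = 0) :
    wp x b (findProg r) σ fun t e σ' => e = 0 ∧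
      (t : ℝ) + 6 * pot U lev ρ χ σ'.mem ≤ 6 * pot U lev ρ χ σ.mem + 6 * R (lev a) + 7 ∧
      FindSpec M U lev rep r a σ σ' := by
  unfold findProg
  simp only [wp_seq, wp_load]
  refine wp.mono (wp_find_loop (lev := lev) (rep := rep) hb hB hw hr (Nat.log 2 M + 1) _ a ?_ ha ?_ ?_ ?_ ?_) ?_
  · exact hf
  · simp [State.setReg_reg, hr.1, hra]
  · simp [State.setReg_reg, State.setReg_mem, hra]
  · simp [State.setReg_reg, h20]
  · omega
  · rintro t e σ' ⟨he, ht, f1, f2, f3, f4⟩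
    refine ⟨by omega, ?_, f1, f2, f3, ?_⟩
    · rw [State.setReg_mem] at ht
      have : (0 : ℝ) ≤ β (lev a) (σ.mem (a + 1)) := by positivity
      push_cast
      linarith
    · intro s s1 s2 s3
      rw [f4 s s1 s2 s3]
      simp [State.setReg_reg, s2]

theorem wp_link {σ : State} {u v : ℕ} (hu : u + 1 < 2 ^ b) (hv : v + 1 < 2 ^ b)
    (hru : σ.mem (u + 1) + 1 < 2 ^ b) (h1b : 1 < 2 ^ b)
    (hne : u ≠ v + 1) (hne' : v ≠ u + 1) (h12 : σ.reg 12 = u) (h13 : σ.reg 13 = v) (h4 : σ.reg 4 = 1) :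
    wp x b linkProg σ fun t e σ' => e = 0 ∧ t ≤ 11 ∧ σ'.mem = link σ.mem u v ∧
      ∀ s, s ≠ 14 → s ≠ 15 → s ≠ 17 → s ≠ 18 → s ≠ 19 → σ'.reg s = σ.reg s := by
  unfold linkProg
  have h1m := Nat.mod_eq_of_lt h1b
  by_cases h : σ.mem (u + 1) < σ.mem (v + 1)
  · simp [Op.eval, h12, h13, h4, Nat.mod_eq_of_lt hu, Nat.mod_eq_of_lt hv, h, h1m]
    refine ⟨?_, ?_⟩
    -- The program does not write the unchanged rank, whereas `attach` rewrites it with its old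
    -- value.
    · unfold link attach
      rw [if_pos h]
      funext a
      simp only [Function.update_apply]
      split_ifs with e1 e2 <;> simp_all
    · intro s a1 a2 a3 a4 a5; simp [a1, a2, a3, a4, a5]
  by_cases h2 : σ.mem (u + 1) = σ.mem (v + 1)
  · simp [Op.eval, h12, h13, h4, Nat.mod_eq_of_lt hu, Nat.mod_eq_of_lt hv, h1m, h2]
    refine ⟨?_, ?_⟩
    · unfold link attach
      rw [if_neg h, if_pos h2, h2, Nat.mod_eq_of_lt (h2 ▸ hru)]
    · intro s a1 a2 a3 a4 a5; simp [a1, a2, a3, a4, a5]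
  · simp [Op.eval, h12, h13, h4, Nat.mod_eq_of_lt hu, Nat.mod_eq_of_lt hv, h, h2]
    refine ⟨?_, ?_⟩
    · unfold link attach
      rw [if_neg h, if_neg h2]
      funext a
      simp only [Function.update_apply]
      split_ifs with e1 e2 <;> simp_all
    · intro s a1 a2 a3 a4 a5; simp [a1, a2, a3, a4, a5]

end LCE

namespace LCE

/-! Synchronized offsets and blocks. -/

/-- The lowest `k` digits of `v` in base `4` are even. -/
def EvenDigits (k v : ℕ) : Prop := ∀ l < k, v / 4 ^ l % 2 = 0

/-- The lowest `k` digits of `v` in base `4` are at most `1`. -/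
def LowDigits (k v : ℕ) : Prop := ∀ l < k, v / 4 ^ l % 4 < 2

/-- The offset `d` is synchronized at level `k` for the positions `i` and `j`. -/
def Sync (i j k d : ℕ) : Prop := EvenDigits k (i + d) ∧ LowDigits k (j + d)

/-- The quotient changes by a multiple of 4, so the base-4 digits below `k` are preserved. -/
theorem add_mul_pow_div (k l v c : ℕ) (h : l < k) :
    (v + c * 4 ^ k) / 4 ^ l = v / 4 ^ l + 4 * (c * 4 ^ (k - l - 1)) := by
  have : c * 4 ^ k = 4 * (c * 4 ^ (k - l - 1)) * 4 ^ l := by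
    have : 4 ^ k = 4 ^ (k - l - 1) * 4 * 4 ^ l := by
      rw [← pow_succ, ← pow_add]; congr 1; omega
    rw [this]; ring
  rw [this, Nat.add_mul_div_right _ _ (by positivity)]

theorem evenDigits_add {k v c : ℕ} : EvenDigits k (v + c * 4 ^ k) ↔ EvenDigits k v := by
  refine forall₂_congr fun l hl => ?_
  rw [add_mul_pow_div k l v c hl]; omega

theorem lowDigits_add {k v c : ℕ} : LowDigits k (v + c * 4 ^ k) ↔ LowDigits k v := by
  refine forall₂_congr fun l hl => ?_
  rw [add_mul_pow_div k l v c hl]; omega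

theorem sync_add {i j k d c : ℕ} : Sync i j k (d + c * 4 ^ k) ↔ Sync i j k d := by
  unfold Sync
  rw [← Nat.add_assoc, ← Nat.add_assoc, evenDigits_add, lowDigits_add]

theorem sync_zero (i j d : ℕ) : Sync i j 0 d := by
  constructor <;> intro l hl <;> omega

theorem sync_succ {i j k d : ℕ} : Sync i j (k + 1) d ↔
    Sync i j k d ∧ (i + d) / 4 ^ k % 2 = 0 ∧ (j + d) / 4 ^ k % 4 < 2 := by
  unfold Sync EvenDigits LowDigits
  simp only [Nat.lt_succ_iff_lt_or_eq, or_imp, forall_and, forall_eq]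
  tauto

theorem sync_succ_add {i j k d c : ℕ} : Sync i j (k + 1) (d + c * 4 ^ k) ↔
    Sync i j k d ∧ ((i + d) / 4 ^ k + c) % 2 = 0 ∧ ((j + d) / 4 ^ k + c) % 4 < 2 := by
  rw [sync_succ, sync_add, ← Nat.add_assoc, ← Nat.add_assoc,
    Nat.add_mul_div_right _ _ (by positivity), Nat.add_mul_div_right _ _ (by positivity)]

/-- Of four consecutive shifts, two make the first number even; they differ by 2, so exactly one of
them brings the second into {0, 1} modulo 4. Starting at 4 instead of 0 ensures that a whole block
of level `k + 1` lies behind the new offset. -/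
theorem exists_sync_succ {i j k d : ℕ} (h : Sync i j k d) :
    ∃ c, 4 ≤ c ∧ c < 8 ∧ Sync i j (k + 1) (d + c * 4 ^ k) := by
  simp only [sync_succ_add, h, true_and]
  generalize (i + d) / 4 ^ k = a
  generalize (j + d) / 4 ^ k = b
  have : ((a + 4) % 2 = 0 ∧ (b + 4) % 4 < 2) ∨ ((a + 5) % 2 = 0 ∧ (b + 5) % 4 < 2) ∨
    ((a + 6) % 2 = 0 ∧ (b + 6) % 4 < 2) ∨ ((a + 7) % 2 = 0 ∧ (b + 7) % 4 < 2) := by omega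
  rcases this with h | h | h | h
  exacts [⟨4, by omega, by omega, h⟩, ⟨5, by omega, by omega, h⟩, ⟨6, by omega, by omega, h⟩,
    ⟨7, by omega, by omega, h⟩]

/-- The uniqueness half: it prevents the loop from rising in the middle of a block of level `k + 1`.
-/
theorem not_sync_succ {i j k d c : ℕ} (h : Sync i j (k + 1) d) (h0 : 0 < c) (h4 : c < 4) :
    ¬ Sync i j (k + 1) (d + c * 4 ^ k) := by
  rw [sync_succ] at h
  rw [sync_succ_add]
  omega

theorem Sync.pred {i j k d : ℕ} (h : Sync i j (k + 1) d) : Sync i j k d := (sync_succ.1 h).1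

/-! ### Addresses and number of blocks. -/

open Classical in
/-- The positions that have a block of level `k`. -/
noncomputable def levelSet (n k : ℕ) : Finset ℕ :=
  (Finset.range (n + 1)).filter fun v => EvenDigits k v ∨ LowDigits k v

theorem le_of_mem_levelSet {n k v : ℕ} (h : v ∈ levelSet n k) : v ≤ n := by
  classical
  have := (Finset.mem_filter.1 h).1
  simpa [Nat.lt_succ_iff] using this

/-- The address of the block of level `k` at position `v`. -/
def addr (n k v : ℕ) : ℕ := (k + 1) * (2 * (n + 1)) + 2 * v

/-- The addresses of all blocks. -/
noncomputable def elems (n : ℕ) : Finset ℕ :=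
  (Finset.range (Nat.log 4 n + 1)).biUnion fun k => (levelSet n k).image (addr n k)

/-- The level of an address. -/
def level (n a : ℕ) : ℕ := a / (2 * (n + 1)) - 1

theorem level_addr {n k v : ℕ} (hv : v ≤ n) : level n (addr n k v) = k := by
  unfold level addr
  rw [Nat.add_comm, Nat.add_mul_div_right _ _ (by positivity), Nat.div_eq_of_lt (by omega)]
  omega

theorem addr_inj {n k v w : ℕ} : addr n k v = addr n k w ↔ v = w := by
  unfold addr; omega

theorem addr_even (n k v : ℕ) : Even (addr n k v) := by
  unfold addr
  rw [show (k + 1) * (2 * (n + 1)) = 2 * ((k + 1) * (n + 1)) by ring]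
  exact (even_two_mul _).add (even_two_mul _)

/-- Frees the value `0` to mark roots, so that zero-initialized memory is already a forest of
singletons. -/
theorem addr_pos (n k v : ℕ) : 0 < addr n k v := by unfold addr; positivity

theorem mem_elems {n a : ℕ} : a ∈ elems n ↔ ∃ k ≤ Nat.log 4 n, ∃ v ≤ n,
    (EvenDigits k v ∨ LowDigits k v) ∧ addr n k v = a := by
  simp only [elems, levelSet, Finset.mem_biUnion, Finset.mem_range, Finset.mem_image,
    Finset.mem_filter, Nat.lt_succ_iff, and_assoc]

theorem addr_lt {n k v : ℕ} (hn : 1 ≤ n) (hk : k ≤ Nat.log 4 n) (hv : v ≤ n) :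
    addr n k v + 1 < 16 * n ^ 2 := by
  have h1 : Nat.log 4 n < n := Nat.log_lt_self _ (by omega)
  have h2 : (k + 1) * (2 * (n + 1)) ≤ n * (2 * (n + 1)) := Nat.mul_le_mul_right _ (by omega)
  unfold addr
  nlinarith

theorem pot_elems (n : ℕ) (f : ℕ → ℕ → ℝ) :
    ∑ a ∈ elems n, f (level n a) a = ∑ k ∈ Finset.range (Nat.log 4 n + 1),
      ∑ v ∈ levelSet n k, f k (addr n k v) := by
  unfold elems
  rw [Finset.sum_biUnion]
  · refine Finset.sum_congr rfl fun k _ => ?_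
    rw [Finset.sum_image fun v _ w _ h => addr_inj.1 h]
    refine Finset.sum_congr rfl fun v hv => ?_
    rw [level_addr (le_of_mem_levelSet hv)]
  · intro k _ l _ hkl
    refine Finset.disjoint_left.2 fun a h1 h2 => hkl ?_
    obtain ⟨v, hv, rfl⟩ := Finset.mem_image.1 h1
    obtain ⟨w, hw, e⟩ := Finset.mem_image.1 h2
    have hv := le_of_mem_levelSet hv
    have hw := le_of_mem_levelSet hw
    rw [← level_addr (k := k) hv, ← e, level_addr hw]

-- Dropping the last digit is at most two-to-one on the counted numbers and shrinks the range
-- fourfold.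
open Classical in
theorem card_digits (P : ℕ → ℕ → Prop) (c₀ c₁ : ℕ)
    (hP : ∀ k v, P (k + 1) v → (v % 4 = c₀ ∨ v % 4 = c₁) ∧ P k (v / 4)) (k : ℕ) :
    ∀ q m, m ≤ q * 4 ^ k → ((Finset.range m).filter (P k)).card ≤ q * 2 ^ k := by
  induction k with
  | zero =>
    intro q m h
    refine (Finset.card_filter_le _ _).trans ?_
    simpa using h
  | succ k ih =>
    intro q m h
    have h1 := ih q ((m + 3) / 4) (by rw [pow_succ, ← mul_assoc] at h; omega)
    set T := (Finset.range ((m + 3) / 4)).filter (P k) with hT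
    have h2 : (Finset.range m).filter (P (k + 1)) ⊆
        T.image (fun w => 4 * w + c₀) ∪ T.image (fun w => 4 * w + c₁) := by
      intro v hv
      obtain ⟨v1, v2⟩ := Finset.mem_filter.1 hv
      have v1 := Finset.mem_range.1 v1
      obtain ⟨q1, q2⟩ := hP _ _ v2
      have hmem : v / 4 ∈ T := Finset.mem_filter.2 ⟨Finset.mem_range.2 (by omega), q2⟩
      rcases q1 with q1 | q1
      · exact Finset.mem_union_left _ (Finset.mem_image.2 ⟨_, hmem, by omega⟩)
      · exact Finset.mem_union_right _ (Finset.mem_image.2 ⟨_, hmem, by omega⟩)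
    have h3 := (Finset.card_le_card h2).trans (Finset.card_union_le _ _)
    have h4 := Finset.card_image_le (s := T) (f := fun w => 4 * w + c₀)
    have h5 := Finset.card_image_le (s := T) (f := fun w => 4 * w + c₁)
    rw [pow_succ]
    linarith

theorem card_levelSet {n k : ℕ} (h : 4 ^ k ≤ n) : (levelSet n k).card * 2 ^ k ≤ 4 * n := by
  classical
  have hq : n + 1 ≤ (n / 4 ^ k + 1) * 4 ^ k := by
    have := Nat.lt_div_mul_add (a := n) (b := 4 ^ k) (by positivity)
    rw [Nat.add_mul]; omega
  have h1 := card_digits EvenDigits 0 2 (fun k v hv => by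
    refine ⟨by have := hv 0 (by omega); simp at this; omega, fun l hl => ?_⟩
    have := hv (l + 1) (by omega)
    rwa [pow_succ', ← Nat.div_div_eq_div_mul] at this) k _ _ hq
  have h2 := card_digits LowDigits 0 1 (fun k v hv => by
    refine ⟨by have := hv 0 (by omega); simp at this; omega, fun l hl => ?_⟩
    have := hv (l + 1) (by omega)
    rwa [pow_succ', ← Nat.div_div_eq_div_mul] at this) k _ _ hq
  have h3 : (levelSet n k).card ≤ 2 * ((n / 4 ^ k + 1) * 2 ^ k) := by
    unfold levelSet
    rw [Finset.filter_or]
    refine (Finset.card_union_le _ _).trans ?_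
    rw [two_mul]
    convert Nat.add_le_add h1 h2 using 1
  have h4 : (2 : ℕ) ^ k * 2 ^ k = 4 ^ k := by rw [← mul_pow]; norm_num
  calc _ ≤ 2 * ((n / 4 ^ k + 1) * 2 ^ k) * 2 ^ k := Nat.mul_le_mul_right _ h3
    _ = 2 * (n / 4 ^ k * 4 ^ k) + 2 * 4 ^ k := by rw [← h4]; ring
    _ ≤ 4 * n := by have := Nat.div_mul_le_self n (4 ^ k); omega

end LCE

namespace LCE

/-! The main loop of a query. -/

/-- Register `16` becomes `1` if the next level can be reached from the current offset, else `0`;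
registers `17` and `18` get the current positions. -/
def condProg : Prog :=
  .seq (.op .add 17 0 7) <| .seq (.op .add 18 1 7) <|
  .seq (.op .div 19 17 8) <| .seq (.op .mod 19 19 5) <|
  .seq (.op .div 21 18 8) <| .seq (.op .mod 21 21 6) <| .seq (.op .lt 21 21 5) <|
  .seq (.op .mul 22 6 8) <| .seq (.op .lt 23 7 22) <|
  .seq (.op .add 19 19 23) <| .seq (.op .eq 19 19 20) <|
  .seq (.op .mul 16 19 21) <| .op .mul 16 16 10

/-- If register `16` holds `1`, go up one level and back to the start of the last block. -/
def shiftProg : Prog :=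
  .ite 16 (.seq (.op .add 8 22 20) <| .seq (.op .add 9 9 3) <|
    .seq (.op .sub 17 17 22) <| .op .sub 18 18 22) .skip

/-- Registers `12` and `13` get the classes of the blocks at the positions in `17` and `18`. -/
def classProg : Prog :=
  .seq (.op .add 12 17 17) <| .seq (.op .add 12 12 9) <|
  .seq (.op .add 13 18 18) <| .seq (.op .add 13 13 9) <| .seq (findProg 12) (findProg 13)

/-- Two blocks of level `0` in different classes are compared. -/
def testProg : Prog :=
  .seq (.eqTest 21 17 18) <| .ite 21 linkProg (.const 11 0)

/-- The current block is skipped, or the next lower level is entered, or symbols are compared. -/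
def stepProg : Prog :=
  .seq (.op .eq 19 12 13) <| .ite 16 (.ite 19 .skip linkProg)
    (.ite 19 (.seq (.op .add 7 7 8) <| .const 10 1)
      (.seq (.const 10 0) <| .seq (.op .eq 21 8 4) <| .ite 21 testProg
        (.seq (.op .div 8 8 6) <| .op .sub 9 9 3)))

/-- One iteration of the main loop of a query. -/
def bodyProg : Prog :=
  .seq condProg <| .seq shiftProg <| .seq classProg stepProg

/-- The registers that are fixed by the preprocessing. -/
structure Consts (n : ℕ) (σ : State) : Prop where
  r2 : σ.reg 2 = n
  r3 : σ.reg 3 = 2 * (n + 1)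
  r4 : σ.reg 4 = 1
  r5 : σ.reg 5 = 2
  r6 : σ.reg 6 = 4
  r20 : σ.reg 20 = 0

/-- The registers at the start of an iteration. -/
structure Regs (n i j k d up : ℕ) (σ : State) : Prop extends Consts n σ where
  r0 : σ.reg 0 = i
  r1 : σ.reg 1 = j
  r7 : σ.reg 7 = d
  r8 : σ.reg 8 = 4 ^ k
  r9 : σ.reg 9 = (k + 1) * (2 * (n + 1))
  r10 : σ.reg 10 = up
  r11 : σ.reg 11 = 1

variable {A : Type*} {x : List A} {b n i j k d up : ℕ} {σ : State}

/-- The next level can be entered at the offset `d`. -/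
def CanRise (i j k d up : ℕ) : Prop := up ≠ 0 ∧ Sync i j (k + 1) d ∧ 4 ^ (k + 1) ≤ d

-- As `d` is synchronized at level `k`, only the digit of index `k` of each position remains to be
-- checked. The conjunction is computed as a product of 0/1 values, and `up` is one of the factors.
open Classical in
theorem wp_cond (hn : 1 ≤ n) (hb : 16 * n ^ 2 ≤ 2 ^ b) (h : Regs n i j k d up σ)
    (hs : Sync i j k d) (hk : 4 ^ k ≤ n) (hi : i + d ≤ n) (hj : j + d ≤ n) (hup : up ≤ 1) :
    wp x b condProg σ fun t e σ' => t = 13 ∧ e = 0 ∧ σ'.mem = σ.mem ∧ Regs n i j k d up σ' ∧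
      σ'.reg 17 = i + d ∧ σ'.reg 18 = j + d ∧ σ'.reg 22 = 4 * 4 ^ k ∧
      σ'.reg 16 = if CanRise i j k d up then 1 else 0 := by
  have hb' : 16 * n ≤ 2 ^ b := by nlinarith
  have hP : 0 < 4 ^ k := by positivity
  have a1 : (i + d) / 4 ^ k ≤ n := (Nat.div_le_self _ _).trans hi
  have a2 : (j + d) / 4 ^ k ≤ n := (Nat.div_le_self _ _).trans hj
  have e1 : (i + d) % 2 ^ b = i + d := Nat.mod_eq_of_lt (by omega)
  have e2 : (j + d) % 2 ^ b = j + d := Nat.mod_eq_of_lt (by omega)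
  have e3 : (i + d) / 4 ^ k % 2 ^ b = (i + d) / 4 ^ k := Nat.mod_eq_of_lt (by omega)
  have e4 : (j + d) / 4 ^ k % 2 ^ b = (j + d) / 4 ^ k := Nat.mod_eq_of_lt (by omega)
  have e5 : (i + d) / 4 ^ k % 2 % 2 ^ b = (i + d) / 4 ^ k % 2 := Nat.mod_eq_of_lt (by omega)
  have e6 : (j + d) / 4 ^ k % 4 % 2 ^ b = (j + d) / 4 ^ k % 4 := Nat.mod_eq_of_lt (by omega)
  have e7 : 4 * 4 ^ k % 2 ^ b = 4 * 4 ^ k := Nat.mod_eq_of_lt (by omega)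
  have e8 : ∀ c < 4, c % 2 ^ b = c := fun c hc => Nat.mod_eq_of_lt (by omega)
  obtain ⟨⟨c2, c3, c4, c5, c6, c20⟩, r0, r1, r7, r8, r9, r10, r11⟩ := h
  unfold condProg
  simp [Op.eval, c5, c6, c20, r0, r1, r7, r8, r10, e1, e2, e3, e4, e5, e6, e7]
  refine ⟨by refine ⟨⟨?_, ?_, ?_, ?_, ?_, ?_⟩, ?_, ?_, ?_, ?_, ?_, ?_, ?_⟩ <;> simp [*], ?_⟩
  unfold CanRise
  rw [sync_succ, pow_succ']
  simp only [hs, true_and]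
  generalize (i + d) / 4 ^ k = u at *
  generalize (j + d) / 4 ^ k = v at *
  generalize 4 ^ k = P at *
  have z1 : 1 % 2 ^ b = 1 := e8 1 (by norm_num)
  have z2 : 2 % 2 ^ b = 2 := e8 2 (by norm_num)
  clear r0 r1 r7 r8 r9 r10 r11 c2 c3 c4 c5 c6 c20 e1 e2 e3 e4 e5 e6 e7 e8 hb hb' hs
  generalize 2 ^ b = B at *
  have q1 : u % 2 = 0 ∨ u % 2 = 1 := by omega
  have q2 : v % 4 ≤ 1 ∧ v % 4 < 2 ∨ ¬ v % 4 ≤ 1 ∧ ¬ v % 4 < 2 := by omega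
  have q3 : d < 4 * P ∧ ¬ 4 * P ≤ d ∨ ¬ d < 4 * P ∧ 4 * P ≤ d := by omega
  have q4 : up = 0 ∨ up = 1 := by omega
  rcases q1 with q1 | q1 <;> rcases q2 with ⟨q2, q2'⟩ | ⟨q2, q2'⟩ <;>
    rcases q3 with ⟨q3, q3'⟩ | ⟨q3, q3'⟩ <;> rcases q4 with q4 | q4 <;>
    simp only [q1, q2, q2', q3, q3', q4, z1, z2, Nat.zero_mod, if_true, if_false, Nat.mul_zero,
      Nat.add_zero, Nat.zero_add, Nat.mul_one, and_true, and_false,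
      ne_eq, not_true, not_false_eq_true, one_ne_zero, Nat.reduceAdd,
      OfNat.ofNat_ne_zero]

theorem wp_shift (hn : 1 ≤ n) (hb : 16 * n ^ 2 ≤ 2 ^ b) (h : Regs n i j k d up σ)
    (h17 : σ.reg 17 = i + d) (h18 : σ.reg 18 = j + d) (h22 : σ.reg 22 = 4 * 4 ^ k) {c : ℕ}
    (h16 : σ.reg 16 = c) (hk : 4 ^ k ≤ n) (hi : i + d ≤ n) (hj : j + d ≤ n)
    (hc : c ≠ 0 → 4 ^ (k + 1) ≤ d) {k' : ℕ} (hk' : k' = if c = 0 then k else k + 1) :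
    wp x b shiftProg σ fun t e σ' => t ≤ 5 ∧ e = 0 ∧ σ'.mem = σ.mem ∧ Regs n i j k' d up σ' ∧
      σ'.reg 17 = (if c = 0 then i + d else i + d - 4 ^ k') ∧
      σ'.reg 18 = (if c = 0 then j + d else j + d - 4 ^ k') ∧
      σ'.reg 16 = c := by
  unfold shiftProg
  by_cases h0 : c = 0
  · subst h0
    rw [if_pos rfl] at hk'
    subst hk'
    simp [h16, h17, h18, h]
  · rw [if_neg h0] at hk'
    subst hk'
    have hc := hc h0
    rw [pow_succ'] at hc
    have hk2 : k + 1 ≤ Nat.log 4 n := by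
      refine Nat.le_log_of_pow_le (by norm_num) ?_
      rw [pow_succ']; omega
    have h9 := addr_lt (n := n) hn hk2 (Nat.zero_le _)
    have e1 : (4 * 4 ^ k) % 2 ^ b = 4 * 4 ^ k := Nat.mod_eq_of_lt (by nlinarith)
    have e2 : (i + d - 4 * 4 ^ k) % 2 ^ b = i + d - 4 * 4 ^ k := Nat.mod_eq_of_lt (by nlinarith [Nat.sub_le (i + d) (4 * 4 ^ k)])
    have e3 : (j + d - 4 * 4 ^ k) % 2 ^ b = j + d - 4 * 4 ^ k := Nat.mod_eq_of_lt (by nlinarith [Nat.sub_le (j + d) (4 * 4 ^ k)])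
    have e4 : ((k + 1) * (2 * (n + 1)) + 2 * (n + 1)) % 2 ^ b = (k + 1 + 1) * (2 * (n + 1)) := by
      unfold addr at h9
      rw [Nat.mod_eq_of_lt]
      · ring
      · linarith
    obtain ⟨⟨c2, c3, c4, c5, c6, c20⟩, r0, r1, r7, r8, r9, r10, r11⟩ := h
    simp [Op.eval, h16, h0, h17, h18, h22, c20, r9, c3, e1, e2, e3, e4, pow_succ']
    refine ⟨⟨?_, ?_, ?_, ?_, ?_, ?_⟩, ?_, ?_, ?_, ?_, ?_, ?_, ?_⟩ <;> simp [*, pow_succ']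

/-- The factors of length `4 ^ l` at `u` and `v` are equal. -/
def SameBlock (x : List A) (l u v : ℕ) : Prop := u = v ∨ IsCommonExt x u v (4 ^ l)

/-- The memory holds classes of equal blocks. -/
structure Blocks (x : List A) (n : ℕ) (m rep : ℕ → ℕ) : Prop where
  forest : RankedForest (n + 1) (elems n) (level n) m rep
  same : ∀ l u v, u ≤ n → v ≤ n → addr n l u ∈ elems n → addr n l v ∈ elems n →
    rep (addr n l u) = rep (addr n l v) → SameBlock x l u v

/-- The parameters of the amortized analysis of time. -/
structure Amort (n : ℕ) (ρ : ℕ → ℕ → ℝ) (χ : ℕ → ℕ → ℕ → ℝ) (g : ℕ → ℝ) (β : ℕ → ℕ → ℕ)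
    (R : ℕ → ℕ) : Prop where
  weights : Weights (Nat.log 2 (n + 1)) ρ χ g
  buckets : Buckets (Nat.log 2 (n + 1)) χ β R

variable {ρ : ℕ → ℕ → ℝ} {χ : ℕ → ℕ → ℕ → ℝ} {g : ℕ → ℝ} {β : ℕ → ℕ → ℕ} {R : ℕ → ℕ}
  {rep : ℕ → ℕ}

theorem elems_lt (hn : 1 ≤ n) (hb : 16 * n ^ 2 ≤ 2 ^ b) : ∀ a ∈ elems n, a + 1 < 2 ^ b := by
  intro a ha
  obtain ⟨k, hk, v, hv, -, rfl⟩ := mem_elems.1 ha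
  exact (addr_lt hn hk hv).trans_le hb

theorem Regs.congr {σ' : State} (h : Regs n i j k d up σ)
    (hf : ∀ s, s < 12 ∨ s = 20 → σ'.reg s = σ.reg s) : Regs n i j k d up σ' := by
  obtain ⟨⟨c2, c3, c4, c5, c6, c20⟩, r0, r1, r7, r8, r9, r10, r11⟩ := h
  refine ⟨⟨?_, ?_, ?_, ?_, ?_, ?_⟩, ?_, ?_, ?_, ?_, ?_, ?_, ?_⟩ <;> rw [hf _ (by omega)] <;>
    assumption

/-- Two finds at `6 * R k + 7` each and four additions. The clause for arbitrary weights allows the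
same run to be measured by `rootCount`. -/
theorem wp_class (hn : 1 ≤ n) (hb : 16 * n ^ 2 ≤ 2 ^ b) (hA : Amort n ρ χ g β R)
    (h : Regs n i j k d up σ) (hB : Blocks x n σ.mem rep) {p q c : ℕ} (h17 : σ.reg 17 = p)
    (h18 : σ.reg 18 = q) (h16 : σ.reg 16 = c) (hp : p ≤ n) (hq : q ≤ n)
    (hpe : addr n k p ∈ elems n) (hqe : addr n k q ∈ elems n) :
    wp x b classProg σ fun t e σ' => e = 0 ∧
      (t : ℝ) + 6 * pot (elems n) (level n) ρ χ σ'.mem ≤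
        6 * pot (elems n) (level n) ρ χ σ.mem + 12 * R k + 18 ∧
      (∀ ρ χ g, Weights (Nat.log 2 (n + 1)) ρ χ g →
        pot (elems n) (level n) ρ χ σ'.mem ≤ pot (elems n) (level n) ρ χ σ.mem) ∧
      Regs n i j k d up σ' ∧ Blocks x n σ'.mem rep ∧ σ'.reg 17 = p ∧ σ'.reg 18 = q ∧
      σ'.reg 16 = c ∧ σ'.reg 12 = rep (addr n k p) ∧ σ'.reg 13 = rep (addr n k q) := by
  have lp := elems_lt hn hb _ hpe
  have lq := elems_lt hn hb _ hqe
  have hlt : ∀ a ∈ elems n, a < 2 ^ b := fun a ha => by have := elems_lt hn hb a ha; omega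
  have h1 : σ.reg 9 = (k + 1) * (2 * (n + 1)) := h.r9
  unfold addr at lp lq
  have e1 : (p + p) % 2 ^ b = p + p := Nat.mod_eq_of_lt (by omega)
  have e2 : (q + q) % 2 ^ b = q + q := Nat.mod_eq_of_lt (by omega)
  have e3 : (p + p + (k + 1) * (2 * (n + 1))) % 2 ^ b = addr n k p := by
    unfold addr; rw [Nat.mod_eq_of_lt (by omega)]; ring
  have e4 : (q + q + (k + 1) * (2 * (n + 1))) % 2 ^ b = addr n k q := by
    unfold addr; rw [Nat.mod_eq_of_lt (by omega)]; ring
  unfold classProg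
  simp [Op.eval, h17, h18, h1, e1, e2, e3, e4]
  refine wp.mono (wp_find (a := addr n k p) (rep := rep) (lev := level n) hlt hA.buckets
    hA.weights (by decide) hB.forest hpe (by simp) (by simp [h.r20])) ?_
  rintro t e σ₁ ⟨he, ht, f1, f2, f3, f4⟩
  refine wp.mono (wp_find (a := addr n k q) (rep := rep) (lev := level n) hlt hA.buckets
    hA.weights (by decide) f1 hqe ?_ ?_) ?_
  · rw [f4 13 (by decide) (by decide) (by decide)]; simp
  · rw [f4 20 (by decide) (by decide) (by decide)]; simp [h.r20]
  rintro t' e' σ₂ ⟨he', ht', f1', f2', f3', f4'⟩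
  rw [level_addr hp] at ht
  rw [level_addr hq] at ht'
  simp only [State.setReg_mem] at ht f2
  have hfr : ∀ s, s ≠ 12 → s ≠ 13 → s ≠ 14 → s ≠ 15 → σ₂.reg s = σ.reg s := by
    intro s s1 s2 s3 s4
    rw [f4' s s2 s3 s4, f4 s s1 s3 s4]
    simp [s1, s2]
  refine ⟨⟨he, he'⟩, ?_, fun ρ χ g hw => (f2' ρ χ g hw).trans (f2 ρ χ g hw), ?_, ⟨f1', hB.same⟩,
    ?_, ?_, ?_, ?_, f3'⟩
  · linarith
  · exact h.congr fun s hs => hfr s (by omega) (by omega) (by omega) (by omega)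
  · rw [hfr _ (by decide) (by decide) (by decide) (by decide), h17]
  · rw [hfr _ (by decide) (by decide) (by decide) (by decide), h18]
  · rw [hfr _ (by decide) (by decide) (by decide) (by decide), h16]
  · rw [f4' _ (by decide) (by decide) (by decide), f3]

end LCE

namespace LCE

/-! Classes of equal blocks. -/

variable {A : Type*} {x : List A} {b n i j k d up : ℕ} {σ : State}
  {ρ : ℕ → ℕ → ℝ} {χ : ℕ → ℕ → ℕ → ℝ} {g : ℕ → ℝ} {β : ℕ → ℕ → ℕ} {R : ℕ → ℕ}
  {rep : ℕ → ℕ}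

theorem IsCommonExt.symm {u v l : ℕ} (h : IsCommonExt x u v l) : IsCommonExt x v u l :=
  ⟨h.2.1, h.1, fun d hd => (h.2.2 d hd).symm⟩

theorem IsCommonExt.trans {u v w l : ℕ} (h : IsCommonExt x u v l) (h' : IsCommonExt x v w l) :
    IsCommonExt x u w l :=
  ⟨h.1, h'.2.1, fun d hd => (h.2.2 d hd).trans (h'.2.2 d hd)⟩

theorem IsCommonExt.drop {u v l : ℕ} (h : IsCommonExt x u v l) {e : ℕ} (he : e ≤ l) :
    IsCommonExt x (u + e) (v + e) (l - e) := by
  obtain ⟨h1, h2, h3⟩ := h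
  refine ⟨by omega, by omega, fun d hd => ?_⟩
  rw [Nat.add_assoc, Nat.add_assoc]
  exact h3 _ (by omega)

theorem IsCommonExt.append {u v l l' : ℕ} (h : IsCommonExt x u v l)
    (h' : IsCommonExt x (u + l) (v + l) l') : IsCommonExt x u v (l + l') := by
  obtain ⟨h1, h2, h3⟩ := h
  obtain ⟨h1', h2', h3'⟩ := h'
  refine ⟨by omega, by omega, fun d hd => ?_⟩
  by_cases hl : d < l
  · exact h3 d hl
  · have := h3' (d - l) (by omega)
    rwa [show u + l + (d - l) = u + d by omega, show v + l + (d - l) = v + d by omega] at this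

theorem SameBlock.symm {l u v : ℕ} (h : SameBlock x l u v) : SameBlock x l v u :=
  h.imp Eq.symm IsCommonExt.symm

theorem SameBlock.trans {l u v w : ℕ} (h : SameBlock x l u v) (h' : SameBlock x l v w) :
    SameBlock x l u w := by
  rcases h with rfl | h
  · exact h'
  · rcases h' with rfl | h'
    · exact Or.inr h
    · exact Or.inr (h.trans h')

/-- The number of classes of blocks of level `0`. -/
noncomputable def rootCount (n : ℕ) (m : ℕ → ℕ) : ℝ :=
  pot (elems n) (level n) (fun l _ => if l = 0 then 1 else 0) (fun _ _ _ => 0) m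

/-- The unit gain at level 0 pays for the equality test that triggers the link. -/
theorem weights_rootCount (N : ℕ) : Weights N (fun l _ => if l = 0 then 1 else 0)
    (fun _ _ _ => 0) fun l => if l = 0 then 1 else 0 where
  anti := by simp
  lt := by intros; split_ifs <;> simp
  eq := by intros; split_ifs <;> norm_num
  nonneg_root := by intros; split_ifs <;> simp
  nonneg := by simp

/-- Every member of the merged class equals the block at `p`, directly or through `q`; the merged
class stays apart from all others, and other levels are not affected. -/
theorem Blocks.link {m : ℕ → ℕ} (hB : Blocks x n m rep) {p q : ℕ} (hp : p ≤ n) (hq : q ≤ n)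
    (hpe : addr n k p ∈ elems n) (hqe : addr n k q ∈ elems n)
    (hne : rep (addr n k p) ≠ rep (addr n k q)) (hs : SameBlock x k p q) :
    ∃ rep', Blocks x n (LCE.link m (rep (addr n k p)) (rep (addr n k q))) rep' ∧
      (∀ ρ χ g, Weights (Nat.log 2 (n + 1)) ρ χ g →
        pot (elems n) (level n) ρ χ (LCE.link m (rep (addr n k p)) (rep (addr n k q))) + g k ≤
          pot (elems n) (level n) ρ χ m) ∧
      (∀ a ∈ elems n, level n a ≠ k → rep' a = rep a) ∧
      rep' (addr n k p) = rep' (addr n k q) := by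
  obtain ⟨u1, u2, u3, u4⟩ := hB.forest.rep _ hpe
  obtain ⟨v1, v2, v3, v4⟩ := hB.forest.rep _ hqe
  rw [level_addr hp] at u3
  rw [level_addr hq] at v3
  have hpos : ∀ a ∈ elems n, a ≠ 0 := by
    intro a ha
    obtain ⟨k, -, v, -, -, rfl⟩ := mem_elems.1 ha
    exact (addr_pos n k v).ne'
  obtain ⟨rep', h1, h2, h3, h4, h5⟩ := hB.forest.link u1 v1 u2 v2 hne (by rw [u3, v3])
    (hpos _ u1) (hpos _ v1)
  have h6 : ∀ a ∈ elems n, level n a ≠ k → rep' a = rep a := by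
    intro a ha hl
    have := (hB.forest.rep a ha).2.2.1
    refine h3 a ?_ ?_ <;> intro e <;> rw [e] at this <;> omega
  refine ⟨rep', ⟨h1, ?_⟩, fun ρ χ g hw => by have := h2 ρ χ g hw; rwa [u3] at this, h6,
    h5 _ _ rfl rfl⟩
  intro l u v hu hv hue hve he
  by_cases hl : l = k
  swap
  · rw [h6 _ hue (by rwa [level_addr hu]), h6 _ hve (by rwa [level_addr hv])] at he
    exact hB.same l u v hu hv hue hve he
  subst hl
  have key : ∀ w ≤ n, addr n l w ∈ elems n → rep (addr n l w) = rep (addr n l p) ∨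
      rep (addr n l w) = rep (addr n l q) → SameBlock x l w p := by
    rintro w hw hwe (e | e)
    · exact hB.same l w p hw hp hwe hpe e
    · exact (hB.same l w q hw hq hwe hqe e).trans hs.symm
  have hmix : ∀ y z, (rep y = rep (addr n l p) ∨ rep y = rep (addr n l q)) →
      ¬ (rep z = rep (addr n l p) ∨ rep z = rep (addr n l q)) → rep' y ≠ rep' z := by
    intro y z hy hz e
    push Not at hz
    have := h4 y hy
    rw [e, h3 z hz.1 hz.2] at this
    tauto
  by_cases c1 : rep (addr n l u) = rep (addr n l p) ∨ rep (addr n l u) = rep (addr n l q)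
  · by_cases c2 : rep (addr n l v) = rep (addr n l p) ∨ rep (addr n l v) = rep (addr n l q)
    · exact (key u hu hue c1).trans (key v hv hve c2).symm
    · exact absurd he (hmix _ _ c1 c2)
  · by_cases c2 : rep (addr n l v) = rep (addr n l p) ∨ rep (addr n l v) = rep (addr n l q)
    · exact absurd he.symm (hmix _ _ c2 c1)
    · push Not at c1 c2
      rw [h3 _ c1.1 c1.2, h3 _ c2.1 c2.2] at he
      exact hB.same l u v hu hv hue hve he

/-- The configuration at the start of an iteration. -/
structure Cfg (x : List A) (n i j k d up : ℕ) (rep : ℕ → ℕ) (σ : State) : Prop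
    extends Regs n i j k d up σ where
  blocks : Blocks x n σ.mem rep
  sync : Sync i j k d
  ext : IsCommonExt x i j d
  pow_le : 4 ^ k ≤ n
  up_le : up ≤ 1

theorem sync_mem_elems (hs : Sync i j k d) (hk : 4 ^ k ≤ n) (hi : i + d ≤ n) (hj : j + d ≤ n) :
    addr n k (i + d) ∈ elems n ∧ addr n k (j + d) ∈ elems n := by
  have := Nat.le_log_of_pow_le (b := 4) (by norm_num) hk
  exact ⟨mem_elems.2 ⟨k, this, _, hi, Or.inl hs.1, rfl⟩,
    mem_elems.2 ⟨k, this, _, hj, Or.inr hs.2, rfl⟩⟩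

/-- The state before the last part of an iteration in which blocks of level `k'` at `p` and `q`
are compared. -/
structure Mid (x : List A) (n i j k' d up c p q : ℕ) (rep : ℕ → ℕ) (σ : State) : Prop
    extends Regs n i j k' d up σ where
  blocks : Blocks x n σ.mem rep
  r17 : σ.reg 17 = p
  r18 : σ.reg 18 = q
  r16 : σ.reg 16 = c
  r12 : σ.reg 12 = rep (addr n k' p)
  r13 : σ.reg 13 = rep (addr n k' q)

-- The part shared by all kinds of iteration; `hQ` leaves only `stepProg` to treat. The constant is
-- 13 for `condProg`, 5 for `shiftProg` and 18 for `classProg`.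
open Classical in
theorem wp_body (hx : x.length = n) (hn : 1 ≤ n) (hb : 16 * n ^ 2 ≤ 2 ^ b)
    (hA : Amort n ρ χ g β R) (h : Cfg x n i j k d up rep σ) {Q : ℕ → ℕ → State → Prop}
    {c k' p q : ℕ} (hc : c = if CanRise i j k d up then 1 else 0)
    (hk' : k' = if CanRise i j k d up then k + 1 else k)
    (hp : p = if CanRise i j k d up then i + (d - 4 ^ k') else i + d)
    (hq : q = if CanRise i j k d up then j + (d - 4 ^ k') else j + d)
    (hQ : ∀ (t₁ : ℕ) (σ₁ : State), (t₁ : ℝ) + 6 * pot (elems n) (level n) ρ χ σ₁.mem ≤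
        6 * pot (elems n) (level n) ρ χ σ.mem + 12 * R k' + 36 →
      rootCount n σ₁.mem ≤ rootCount n σ.mem →
      Mid x n i j k' d up c p q rep σ₁ → p ≤ n → q ≤ n → addr n k' p ∈ elems n →
      addr n k' q ∈ elems n →
      wp x b stepProg σ₁ fun t e σ' => Q (t₁ + t) e σ') :
    wp x b bodyProg σ Q := by
  have hi : i + d ≤ n := hx ▸ h.ext.1
  have hj : j + d ≤ n := hx ▸ h.ext.2.1
  have hmem : p ≤ n ∧ q ≤ n ∧ addr n k' p ∈ elems n ∧ addr n k' q ∈ elems n := by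
    have hpow : 0 < 4 ^ k' := by positivity
    split_ifs at hk' hp hq with hr
    · obtain ⟨r1, r2, r3⟩ := hr
      rw [← hk'] at r2 r3
      -- Synchronization depends only on the offset modulo `4 ^ k'`, so the start of the block just
      -- completed is synchronized too.
      have := sync_mem_elems (n := n) (d := d - 4 ^ k') (k := k') (i := i) (j := j)
        (by rw [← sync_add (c := 1), one_mul, Nat.sub_add_cancel r3]; exact r2) (by omega)
        (by omega) (by omega)
      rw [hp, hq]
      exact ⟨by omega, by omega, this⟩
    · rw [hp, hq, hk']
      exact ⟨hi, hj, sync_mem_elems h.sync h.pow_le hi hj⟩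
  obtain ⟨hpn, hqn, hpe, hqe⟩ := hmem
  unfold bodyProg
  rw [wp_seq]
  refine (wp_cond hn hb h.toRegs h.sync h.pow_le hi hj h.up_le).mono ?_
  rintro t e σ₁ ⟨rfl, rfl, m1, g1, g17, g18, g22, g16⟩
  rw [wp_seq]
  rw [← hc] at g16
  have hc0 : c = 0 ↔ ¬ CanRise i j k d up := by rw [hc]; split_ifs with h <;> simp [h]
  refine (wp_shift hn hb g1 g17 g18 g22 g16 h.pow_le hi hj
    (fun h0 => by rw [ne_eq, hc0, not_not] at h0; exact h0.2.2) (k' := k')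
    (by rw [hk']; simp only [hc0, ite_not])).mono ?_
  rintro t e σ₂ ⟨ht2, rfl, m2, s2, s17, s18, s16⟩
  rw [wp_seq]
  have e17 : σ₂.reg 17 = p := by
    rw [s17, hp]
    simp only [hc0, ite_not]
    split_ifs with hr
    · have := hr.2.2; rw [if_pos hr] at hk'; rw [← hk'] at this; omega
    · rfl
  have e18 : σ₂.reg 18 = q := by
    rw [s18, hq]
    simp only [hc0, ite_not]
    split_ifs with hr
    · have := hr.2.2; rw [if_pos hr] at hk'; rw [← hk'] at this; omega
    · rfl
  have hB2 : Blocks x n σ₂.mem rep := by rw [m2, m1]; exact h.blocks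
  refine (wp_class hn hb hA s2 hB2 e17 e18 s16 hpn hqn hpe hqe).mono ?_
  rintro t' e' σ₃ ⟨rfl, ht3, f3, q1, q2, q17, q18, q16, q12, q13⟩
  rw [m2, m1] at ht3 f3
  have := hQ (13 + (t + t')) σ₃ (by
    have : (t : ℝ) ≤ 5 := by exact_mod_cast ht2
    push_cast; linarith) (f3 _ _ _ (weights_rootCount _)) ⟨q1, q2, q17, q18, q16, q12, q13⟩
    hpn hqn hpe hqe
  refine this.mono fun t'' e'' σ'' hQ' => ?_
  simp only [Nat.zero_add]
  convert hQ' using 1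
  ring

end LCE

namespace LCE

/-! The iterations of the main loop. -/

variable {A : Type*} {x : List A} {b n i j k d up : ℕ} {σ : State}
  {ρ : ℕ → ℕ → ℝ} {χ : ℕ → ℕ → ℕ → ℝ} {g : ℕ → ℝ} {β : ℕ → ℕ → ℕ} {R : ℕ → ℕ}
  {rep : ℕ → ℕ}

/-- The potential of the analysis of time. -/
noncomputable def timePot (n : ℕ) (ρ : ℕ → ℕ → ℝ) (χ : ℕ → ℕ → ℕ → ℝ) (σ : State) : ℝ :=
  6 * pot (elems n) (level n) ρ χ σ.mem

theorem wp_link_blocks (hn : 1 ≤ n) (hb : 16 * n ^ 2 ≤ 2 ^ b)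
    (hA : Amort n ρ χ g β R) (h : Regs n i j k d up σ) (hB : Blocks x n σ.mem rep) {l p q : ℕ}
    (h12 : σ.reg 12 = rep (addr n l p)) (h13 : σ.reg 13 = rep (addr n l q))
    (hp : p ≤ n) (hq : q ≤ n) (hpe : addr n l p ∈ elems n) (hqe : addr n l q ∈ elems n)
    (hne : rep (addr n l p) ≠ rep (addr n l q)) (hs : SameBlock x l p q) :
    wp x b linkProg σ fun t e σ' => e = 0 ∧ t ≤ 11 ∧ Regs n i j k d up σ' ∧
      ∃ rep', Blocks x n σ'.mem rep' ∧ timePot n ρ χ σ' + 6 * g l ≤ timePot n ρ χ σ ∧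
        rootCount n σ'.mem + (if l = 0 then 1 else 0) ≤ rootCount n σ.mem ∧
        (∀ a ∈ elems n, level n a ≠ l → rep' a = rep a) ∧
        rep' (addr n l p) = rep' (addr n l q) := by
  obtain ⟨u1, -⟩ := hB.forest.rep _ hpe
  obtain ⟨v1, -⟩ := hB.forest.rep _ hqe
  have hu := elems_lt hn hb _ u1
  have hv := elems_lt hn hb _ v1
  have hr := hB.forest.rank_le u1
  have hlog : Nat.log 2 (n + 1) < n + 1 := Nat.log_lt_self _ (by omega)
  have eu := hB.forest.even _ u1
  have ev := hB.forest.even _ v1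
  refine (wp_link hu hv (by nlinarith) (by nlinarith) (by grind) (by grind) h12 h13 h.r4).mono ?_
  rintro t e σ' ⟨he, ht, hm, hf⟩
  obtain ⟨rep', b1, b2, b3, b4⟩ := hB.link hp hq hpe hqe hne hs
  refine ⟨he, ht, h.congr fun s hs => hf s (by omega) (by omega) (by omega) (by omega) (by omega),
    rep', hm ▸ b1, ?_, ?_, b3, b4⟩
  · have := b2 _ _ _ hA.weights
    unfold timePot
    rw [hm]; linarith
  · have := b2 _ _ _ (weights_rootCount _)
    unfold rootCount
    rw [hm]; exact this

/-- An iteration that enters the next level. -/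
theorem wp_body_rise (hx : x.length = n) (hn : 1 ≤ n) (hb : 16 * n ^ 2 ≤ 2 ^ b)
    (hA : Amort n ρ χ g β R) (h : Cfg x n i j k d up rep σ) (hr : CanRise i j k d up)
    (hg : 0 ≤ g (k + 1)) :
    wp x b bodyProg σ fun t e σ' => e = 0 ∧ ∃ rep', Cfg x n i j (k + 1) d up rep' σ' ∧
      t + timePot n ρ χ σ' ≤ timePot n ρ χ σ + 12 * R (k + 1) + 59 ∧
      (rep (addr n (k + 1) (i + (d - 4 ^ (k + 1)))) ≠
          rep (addr n (k + 1) (j + (d - 4 ^ (k + 1)))) →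
        t + timePot n ρ χ σ' + 6 * g (k + 1) ≤ timePot n ρ χ σ + 12 * R (k + 1) + 59) ∧
      rootCount n σ'.mem ≤ rootCount n σ.mem ∧
      ∀ a ∈ elems n, level n a ≠ k + 1 → rep' a = rep a := by
  have hi : i + d ≤ n := hx ▸ h.ext.1
  have h1b : 1 < 2 ^ b := by nlinarith
  have hpow : 0 < 4 ^ k := by positivity
  obtain ⟨r1, r2, r3⟩ := hr
  refine wp_body hx hn hb hA h (c := 1) (k' := k + 1) (p := i + (d - 4 ^ (k + 1)))
    (q := j + (d - 4 ^ (k + 1))) (if_pos ⟨r1, r2, r3⟩).symm (if_pos ⟨r1, r2, r3⟩).symm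
    (if_pos ⟨r1, r2, r3⟩).symm (if_pos ⟨r1, r2, r3⟩).symm ?_
  intro t₁ σ₁ ht hroot hM hp hq hpe hqe
  have hR := hM.toRegs
  unfold stepProg
  simp only [wp_seq, wp_op, Op.eval, hM.r12, hM.r13]
  by_cases heq : rep (addr n (k + 1) (i + (d - 4 ^ (k + 1)))) =
      rep (addr n (k + 1) (j + (d - 4 ^ (k + 1))))
  · simp only [if_pos heq, Nat.mod_eq_of_lt h1b]
    simp only [wp_ite, wp_skip, State.setReg_reg, Nat.reduceEqDiff, if_false, if_true, hM.r16,
      one_ne_zero]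
    refine ⟨trivial, rep, ⟨hR.congr fun s hs => ?_, hM.blocks, r2, h.ext, by omega, h.up_le⟩, ?_,
      fun hne => absurd heq hne, hroot, fun _ _ _ => rfl⟩
    · rw [State.setReg_reg, if_neg (by omega)]
    · unfold timePot
      rw [State.setReg_mem]
      push_cast; linarith
  · simp only [if_neg heq, Nat.zero_mod]
    simp only [wp_ite, State.setReg_reg, Nat.reduceEqDiff, if_false, if_true, hM.r16,
      one_ne_zero]
    -- These blocks are the tail of the common extension already established; no comparison is
    -- needed.
    have hsame : SameBlock x (k + 1) (i + (d - 4 ^ (k + 1))) (j + (d - 4 ^ (k + 1))) := by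
      have := h.ext.drop (e := d - 4 ^ (k + 1)) (by omega)
      rw [show d - (d - 4 ^ (k + 1)) = 4 ^ (k + 1) by omega] at this
      exact Or.inr this
    refine (wp_link_blocks hn hb hA (σ := σ₁.setReg 19 0) (k := k + 1) (i := i) (j := j) (d := d)
      (up := up) (hR.congr fun s hs => ?_) (rep := rep) hM.blocks
      hM.r12 hM.r13 hp hq hpe hqe heq hsame).mono ?_
    · rw [State.setReg_reg, if_neg (by omega)]
    rintro t e σ' ⟨rfl, ht', hR', rep', b1, b2, b3, b4, -⟩
    have e1 : timePot n ρ χ (σ₁.setReg 19 0) = 6 * pot (elems n) (level n) ρ χ σ₁.mem := rfl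
    rw [e1] at b2
    have ht'' : (t : ℝ) ≤ 11 := by exact_mod_cast ht'
    have e2 : timePot n ρ χ σ = 6 * pot (elems n) (level n) ρ χ σ.mem := rfl
    refine ⟨rfl, rep', ⟨hR', b1, r2, h.ext, by omega, h.up_le⟩, ?_, fun _ => ?_, ?_, b4⟩
    · push_cast; linarith
    · push_cast; linarith
    · simp only [State.setReg_mem, if_neg (Nat.succ_ne_zero k)] at b3
      linarith

/-- An iteration that skips a block. -/
theorem wp_body_jump (hx : x.length = n) (hn : 1 ≤ n) (hb : 16 * n ^ 2 ≤ 2 ^ b)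
    (hA : Amort n ρ χ g β R) (h : Cfg x n i j k d up rep σ) (hr : ¬ CanRise i j k d up)
    (hij : i ≠ j) (heq : rep (addr n k (i + d)) = rep (addr n k (j + d))) :
    wp x b bodyProg σ fun t e σ' => e = 0 ∧ Cfg x n i j k (d + 4 ^ k) 1 rep σ' ∧
      t + timePot n ρ χ σ' ≤ timePot n ρ χ σ + 12 * R k + 59 ∧
      rootCount n σ'.mem ≤ rootCount n σ.mem := by
  have h1b : 1 < 2 ^ b := by nlinarith
  refine wp_body hx hn hb hA h (c := 0) (k' := k) (p := i + d) (q := j + d) (if_neg hr).symm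
    (if_neg hr).symm (if_neg hr).symm (if_neg hr).symm ?_
  intro t₁ σ₁ ht hroot hM hp hq hpe hqe
  have hext : IsCommonExt x i j (d + 4 ^ k) := by
    -- `SameBlock` admits `u = v` because a block may stick out of the word; here `i ≠ j` rules that
    -- case out.
    rcases hM.blocks.same k _ _ hp hq hpe hqe heq with e | e
    · omega
    · exact h.ext.append e
  have hd : (d + 4 ^ k) % 2 ^ b = d + 4 ^ k := by
    have := hext.1
    rw [hx] at this
    exact Nat.mod_eq_of_lt (by nlinarith)
  unfold stepProg
  simp only [wp_seq, wp_op, Op.eval, hM.r12, hM.r13, if_pos heq, Nat.mod_eq_of_lt h1b, wp_ite,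
    wp_const, State.setReg_reg, Nat.reduceEqDiff, if_false, if_true, hM.r16, one_ne_zero, hM.r7,
    hM.r8, hd]
  refine ⟨trivial, ⟨?_, hM.blocks, ?_, hext, h.pow_le, le_rfl⟩, ?_, hroot⟩
  · obtain ⟨⟨c2, c3, c4, c5, c6, c20⟩, r0, r1, r7, r8, r9, r10, r11⟩ := hM.toRegs
    refine ⟨⟨?_, ?_, ?_, ?_, ?_, ?_⟩, ?_, ?_, ?_, ?_, ?_, ?_, ?_⟩ <;>
      simp only [State.setReg_reg, Nat.reduceEqDiff, if_false, if_true] <;> assumption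
  · have := sync_add (c := 1) (i := i) (j := j) (k := k) (d := d)
    rw [one_mul] at this
    exact this.2 h.sync
  · unfold timePot
    simp only [State.setReg_mem]
    push_cast; linarith

/-- An iteration that enters the next lower level. -/
theorem wp_body_descend (hx : x.length = n) (hn : 1 ≤ n) (hb : 16 * n ^ 2 ≤ 2 ^ b)
    (hA : Amort n ρ χ g β R) (h : Cfg x n i j (k + 1) d up rep σ)
    (hr : ¬ CanRise i j (k + 1) d up)
    (hne : rep (addr n (k + 1) (i + d)) ≠ rep (addr n (k + 1) (j + d))) :
    wp x b bodyProg σ fun t e σ' => e = 0 ∧ Cfg x n i j k d 0 rep σ' ∧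
      t + timePot n ρ χ σ' ≤ timePot n ρ χ σ + 12 * R (k + 1) + 59 ∧
      rootCount n σ'.mem ≤ rootCount n σ.mem := by
  have h1b : 1 < 2 ^ b := by nlinarith
  refine wp_body hx hn hb hA h (c := 0) (k' := k + 1) (p := i + d) (q := j + d) (if_neg hr).symm
    (if_neg hr).symm (if_neg hr).symm (if_neg hr).symm ?_
  intro t₁ σ₁ ht hroot hM hp hq hpe hqe
  have hpow := h.pow_le
  rw [pow_succ'] at hpow
  have hk : 4 * 4 ^ k ≠ 1 := by omega
  have hd : 4 ^ k % 2 ^ b = 4 ^ k := Nat.mod_eq_of_lt (by nlinarith)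
  have hlt := addr_lt (n := n) (k := k) hn (Nat.le_log_of_pow_le (by norm_num) (by omega))
    (Nat.zero_le _)
  have hs : ((k + 1 + 1) * (2 * (n + 1)) - 2 * (n + 1)) % 2 ^ b = (k + 1) * (2 * (n + 1)) := by
    rw [Nat.add_mul (k + 1) 1, one_mul, Nat.add_sub_cancel]
    unfold addr at hlt
    exact Nat.mod_eq_of_lt (by omega)
  unfold stepProg
  simp only [wp_seq, wp_op, Op.eval, hM.r12, hM.r13, if_neg hne, Nat.zero_mod, wp_ite,
    wp_const, State.setReg_reg, Nat.reduceEqDiff, if_false, if_true, hM.r16, hM.r4, hM.r6, hM.r3,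
    hM.r9, hM.r8, pow_succ', hk, Nat.mul_div_cancel_left _ (Nat.zero_lt_succ 3), hd, hs]
  refine ⟨trivial, ⟨?_, hM.blocks, h.sync.pred, h.ext, by omega, Nat.zero_le _⟩, ?_, hroot⟩
  · obtain ⟨⟨c2, c3, c4, c5, c6, c20⟩, r0, r1, r7, r8, r9, r10, r11⟩ := hM.toRegs
    refine ⟨⟨?_, ?_, ?_, ?_, ?_, ?_⟩, ?_, ?_, ?_, ?_, ?_, ?_, ?_⟩ <;>
      simp only [State.setReg_reg, Nat.reduceEqDiff, if_false, if_true] <;> assumption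
  · unfold timePot
    simp only [State.setReg_mem]
    push_cast; linarith

/-- An iteration in which two symbols are found to be equal. -/
theorem wp_body_test (hx : x.length = n) (hn : 1 ≤ n) (hb : 16 * n ^ 2 ≤ 2 ^ b)
    (hA : Amort n ρ χ g β R) (h : Cfg x n i j 0 d up rep σ)
    (hr : ¬ CanRise i j 0 d up)
    (hne : rep (addr n 0 (i + d)) ≠ rep (addr n 0 (j + d))) (heq : symEq x (i + d) (j + d) = 1) :
    wp x b bodyProg σ fun t e σ' => e = 1 ∧ ∃ rep', Cfg x n i j 0 d 0 rep' σ' ∧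
      t + timePot n ρ χ σ' + 6 * g 0 ≤ timePot n ρ χ σ + 12 * R 0 + 59 ∧
      rootCount n σ'.mem + 1 ≤ rootCount n σ.mem ∧
      (∀ a ∈ elems n, level n a ≠ 0 → rep' a = rep a) ∧
      rep' (addr n 0 (i + d)) = rep' (addr n 0 (j + d)) := by
  have h1b : 1 < 2 ^ b := by nlinarith
  refine wp_body hx hn hb hA h (c := 0) (k' := 0) (p := i + d) (q := j + d) (if_neg hr).symm
    (if_neg hr).symm (if_neg hr).symm (if_neg hr).symm ?_
  intro t₁ σ₁ ht hroot hM hp hq hpe hqe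
  have hsame : SameBlock x 0 (i + d) (j + d) := by
    unfold symEq at heq
    split_ifs at heq with hc
    refine Or.inr ⟨hc.1, hc.2.1, fun d hd => ?_⟩
    obtain rfl : d = 0 := by simpa using hd
    exact hc.2.2
  unfold stepProg testProg
  simp only [wp_seq, wp_op, Op.eval, hM.r12, hM.r13, if_neg hne, Nat.zero_mod, wp_ite, wp_eqTest,
    wp_const, State.setReg_reg, Nat.reduceEqDiff, if_false, if_true, hM.r16, hM.r4,
    hM.r8, pow_zero, hM.r17, hM.r18, heq, Nat.mod_eq_of_lt h1b, one_ne_zero]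
  refine (wp_link_blocks hn hb hA (σ := (((σ₁.setReg 19 0).setReg 10 0).setReg 21 1).setReg 21 1)
      (k := 0) (i := i) (j := j) (d := d) (l := 0) (up := 0) ?_ (rep := rep) hM.blocks
      hM.r12 hM.r13 hp hq hpe hqe hne hsame).mono ?_
  · obtain ⟨⟨c2, c3, c4, c5, c6, c20⟩, r0, r1, r7, r8, r9, r10, r11⟩ := hM.toRegs
    refine ⟨⟨?_, ?_, ?_, ?_, ?_, ?_⟩, ?_, ?_, ?_, ?_, ?_, ?_, ?_⟩ <;>
      simp only [State.setReg_reg, Nat.reduceEqDiff, if_false, if_true] <;> assumption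
  rintro t e σ' ⟨rfl, ht', hR', rep', b1, b2, b3, b4, b5⟩
  have ht'' : (t : ℝ) ≤ 11 := by exact_mod_cast ht'
  unfold timePot at b2 ⊢
  simp only [State.setReg_mem, if_true] at b2 b3
  refine ⟨rfl, rep', ⟨hR', b1, h.sync, h.ext, h.pow_le, Nat.zero_le _⟩, ?_, ?_, b4, b5⟩
  · push_cast; linarith
  · linarith

/-- An iteration in which two symbols are found to be different. -/
theorem wp_body_stop (hx : x.length = n) (hn : 1 ≤ n) (hb : 16 * n ^ 2 ≤ 2 ^ b)
    (hA : Amort n ρ χ g β R) (h : Cfg x n i j 0 d up rep σ)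
    (hr : ¬ CanRise i j 0 d up)
    (hne : rep (addr n 0 (i + d)) ≠ rep (addr n 0 (j + d))) (heq : symEq x (i + d) (j + d) = 0) :
    wp x b bodyProg σ fun t e σ' => e = 1 ∧ Consts n σ' ∧ Blocks x n σ'.mem rep ∧
      σ'.reg 7 = d ∧ σ'.reg 11 = 0 ∧
      t + timePot n ρ χ σ' ≤ timePot n ρ χ σ + 12 * R 0 + 59 ∧
      rootCount n σ'.mem ≤ rootCount n σ.mem := by
  have h1b : 1 < 2 ^ b := by nlinarith
  refine wp_body hx hn hb hA h (c := 0) (k' := 0) (p := i + d) (q := j + d) (if_neg hr).symm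
    (if_neg hr).symm (if_neg hr).symm (if_neg hr).symm ?_
  intro t₁ σ₁ ht hroot hM hp hq hpe hqe
  unfold stepProg testProg
  simp only [wp_seq, wp_op, Op.eval, hM.r12, hM.r13, if_neg hne, Nat.zero_mod, wp_ite, wp_eqTest,
    wp_const, State.setReg_reg, Nat.reduceEqDiff, if_false, if_true, hM.r16, hM.r4,
    hM.r8, pow_zero, hM.r17, hM.r18, heq, Nat.mod_eq_of_lt h1b, one_ne_zero]
  refine ⟨trivial, ?_, hM.blocks, hM.r7, trivial, ?_, hroot⟩
  · obtain ⟨c2, c3, c4, c5, c6, c20⟩ := hM.toConsts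
    refine ⟨?_, ?_, ?_, ?_, ?_, ?_⟩ <;>
      simp only [State.setReg_reg, Nat.reduceEqDiff, if_false] <;> assumption
  · unfold timePot
    simp only [State.setReg_mem]
    push_cast; linarith

end LCE

namespace LCE

/-! Amortized cost of a query. -/

variable {A : Type*} {x : List A} {b n i j k d up : ℕ} {σ : State}
  {ρ : ℕ → ℕ → ℝ} {χ : ℕ → ℕ → ℕ → ℝ} {g : ℕ → ℝ} {β : ℕ → ℕ → ℕ} {R : ℕ → ℕ}
  {rep : ℕ → ℕ} {s : ℝ} {a : ℕ → ℝ}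

/-- From the state `σ`, the main loop of a query computes the longest common extension within
amortized time `s` and one amortized equality test. -/
def Finishes (x : List A) (b n i j : ℕ) (ρ : ℕ → ℕ → ℝ) (χ : ℕ → ℕ → ℕ → ℝ) (σ : State) (s : ℝ) :
    Prop :=
  wp x b (.loop 11 bodyProg) σ fun t e σ' => Consts n σ' ∧ (∃ rep, Blocks x n σ'.mem rep) ∧
    σ'.reg 7 = lce x i j ∧ t + timePot n ρ χ σ' ≤ timePot n ρ χ σ + s ∧
    e + rootCount n σ'.mem ≤ rootCount n σ.mem + 1

theorem Finishes.mono {s' : ℝ} (h : Finishes x b n i j ρ χ σ s) (hs : s ≤ s') :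
    Finishes x b n i j ρ χ σ s' :=
  wp.mono h fun _ _ _ ⟨h1, h2, h3, h4, h5⟩ => ⟨h1, h2, h3, h4.trans (by linarith), h5⟩

theorem Finishes.step (h11 : σ.reg 11 ≠ 0)
    (h : wp x b bodyProg σ fun t e σ' => ∃ s', Finishes x b n i j ρ χ σ' s' ∧
      t + timePot n ρ χ σ' + s' + 1 ≤ timePot n ρ χ σ + s ∧
      e + rootCount n σ'.mem ≤ rootCount n σ.mem) :
    Finishes x b n i j ρ χ σ s := by
  refine wp_loop_step h11 (h.mono ?_)
  rintro t e σ' ⟨s', h1, h2, h3⟩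
  refine wp.mono h1 ?_
  rintro t' e' σ'' ⟨q1, q2, q3, q4, q5⟩
  refine ⟨q1, q2, q3, ?_, ?_⟩
  · push_cast; linarith
  · push_cast; linarith

/-- Costs that the gains `g` of links can pay. -/
structure Costs (n : ℕ) (ρ : ℕ → ℕ → ℝ) (χ : ℕ → ℕ → ℕ → ℝ) (g : ℕ → ℝ) (β : ℕ → ℕ → ℕ)
    (R : ℕ → ℕ) (a : ℕ → ℝ) : Prop extends Amort n ρ χ g β R where
  le : ∀ k, 12 * R k + 61 ≤ a k
  gain_zero : a 0 ≤ 6 * g 0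
  gain_succ : ∀ k, a (k + 1) + 4 * a k ≤ 6 * g (k + 1)

theorem Costs.pos (hC : Costs n ρ χ g β R a) (k : ℕ) : 61 ≤ a k := by
  have := hC.le k
  have : (0 : ℝ) ≤ R k := by positivity
  linarith

theorem lce_eq {l : ℕ} (h : IsCommonExt x i j l) (h' : ¬ IsCommonExt x i j (l + 1)) :
    lce x i j = l := by
  have hi := h.1
  have hj := h.2.1
  obtain ⟨h1, h2⟩ := isGreatest_lce x (i := i) (j := j) (by omega) (by omega)
  refine le_antisymm ?_ (h2 h)
  by_contra hlt
  exact h' ⟨by have := h1.1; omega, by have := h1.2.1; omega,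
    fun d hd => h1.2.2 d (by omega)⟩

/-- A test outside the word fails as well, so the end of the word needs no separate treatment. -/
theorem lce_of_symEq (h : IsCommonExt x i j d) (h0 : symEq x (i + d) (j + d) = 0) :
    lce x i j = d := by
  refine lce_eq h fun h' => ?_
  unfold symEq at h0
  rw [if_pos ⟨by have := h'.1; omega, by have := h'.2.1; omega, h'.2.2 d (by omega)⟩] at h0
  exact one_ne_zero h0

/-- The amortized cost of a block in which the words differ. -/
def failCost (a : ℕ → ℝ) (k : ℕ) : ℝ := a k + 4 * ∑ l ∈ Finset.range k, a l

/-- One descent, at most three equal sub-blocks, then the sub-block containing the mismatch. -/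
theorem failCost_succ (k : ℕ) : failCost a (k + 1) = a (k + 1) + 3 * a k + failCost a k := by
  unfold failCost
  rw [Finset.sum_range_succ]
  ring

theorem not_canRise_zero : ¬ CanRise i j k d 0 := fun h => h.1 rfl

theorem Finishes.jump (hx : x.length = n) (hn : 1 ≤ n) (hb : 16 * n ^ 2 ≤ 2 ^ b) (hij : i ≠ j)
    (hC : Costs n ρ χ g β R a) (h : Cfg x n i j k d up rep σ) (hr : ¬ CanRise i j k d up)
    (heq : rep (addr n k (i + d)) = rep (addr n k (j + d)))
    (hQ : ∀ σ', Cfg x n i j k (d + 4 ^ k) 1 rep σ' → Finishes x b n i j ρ χ σ' (s - a k)) :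
    Finishes x b n i j ρ χ σ s := by
  refine .step (by rw [h.r11]; exact one_ne_zero)
    ((wp_body_jump hx hn hb hC.toAmort h hr hij heq).mono ?_)
  rintro t e σ' ⟨rfl, h1, h2, h3⟩
  refine ⟨_, hQ _ h1, by linarith [hC.le k], by push_cast; linarith⟩

/-- A block is handled with the help of the blocks of lower levels. -/
theorem Finishes.block (hx : x.length = n) (hn : 1 ≤ n) (hb : 16 * n ^ 2 ≤ 2 ^ b) (hij : i ≠ j)
    (hC : Costs n ρ χ g β R a) (k : ℕ) : ∀ (d up : ℕ) (rep : ℕ → ℕ) (σ : State) (s : ℝ),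
    Cfg x n i j k d up rep σ → ¬ CanRise i j k d up → failCost a k ≤ s →
    (∀ rep' σ', Cfg x n i j k (d + 4 ^ k) 1 rep' σ' →
      (∀ c ∈ elems n, k < level n c → rep' c = rep c) →
      Finishes x b n i j ρ χ σ' (s - a k)) →
    Finishes x b n i j ρ χ σ s := by
  -- The continuation keeps `s - a k`: a block that proves equal costs net one iteration, since its
  -- link pays for the rest. Only a block with a mismatch uses the full `failCost`. Classes above
  -- level `k` are tracked so that the later link of an enclosing block is known to merge distinct
  -- classes.
  induction k with
  | zero =>
    intro d up rep σ s h hr hs hQ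
    by_cases heq : rep (addr n 0 (i + d)) = rep (addr n 0 (j + d))
    · exact .jump hx hn hb hij hC h hr heq fun σ' h' => hQ _ _ h' fun _ _ _ => rfl
    have h01 : symEq x (i + d) (j + d) = 0 ∨ symEq x (i + d) (j + d) = 1 := by
      unfold symEq; split_ifs <;> simp
    have hs' : a 0 ≤ s := by simpa [failCost] using hs
    rcases h01 with h0 | h1
    · refine wp_loop_step (by rw [h.r11]; exact one_ne_zero)
        ((wp_body_stop hx hn hb hC.toAmort h hr heq h0).mono ?_)
      rintro t e σ' ⟨rfl, q1, q2, q3, q4, q5, q6⟩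
      refine wp_loop_done q4 ⟨q1, ⟨_, q2⟩, q3.trans (lce_of_symEq h.ext h0).symm, ?_, ?_⟩
      · push_cast; linarith [hC.le 0]
      · push_cast; linarith
    · refine .step (by rw [h.r11]; exact one_ne_zero)
        ((wp_body_test hx hn hb hC.toAmort h hr heq h1).mono ?_)
      rintro t e σ' ⟨rfl, rep', q1, q2, q3, q4, q5⟩
      refine ⟨s, ?_, by linarith [hC.le 0, hC.gain_zero], by push_cast; linarith⟩
      refine .jump hx hn hb hij hC q1 not_canRise_zero q5 fun σ'' h'' => hQ _ _ h'' ?_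
      exact fun c hc hl => q4 c hc (by omega)
  | succ k ih =>
    intro d up rep σ s h hr hs hQ
    by_cases heq : rep (addr n (k + 1) (i + d)) = rep (addr n (k + 1) (j + d))
    · exact .jump hx hn hb hij hC h hr heq fun σ' h' => hQ _ _ h' fun _ _ _ => rfl
    have hak := hC.pos k
    rw [failCost_succ] at hs
    -- No rise can interrupt the four sub-blocks: at the first one `up = 0`, and the offsets before
    -- the others are not synchronized at level `k + 1`.
    have blk : ∀ c < 4, ∀ (up : ℕ) (rep : ℕ → ℕ) (σ : State) (s : ℝ), (c = 0 → up = 0) →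
        Cfg x n i j k (d + c * 4 ^ k) up rep σ → failCost a k ≤ s →
        (∀ rep' σ', Cfg x n i j k (d + (c + 1) * 4 ^ k) 1 rep' σ' →
          (∀ c ∈ elems n, k < level n c → rep' c = rep c) →
          Finishes x b n i j ρ χ σ' (s - a k)) →
        Finishes x b n i j ρ χ σ s := by
      intro c hc up rep σ s hup hcfg hs hQ
      refine ih _ _ _ _ _ hcfg ?_ hs fun rep' σ' h' => hQ rep' σ' (by
        convert h' using 1; ring)
      rintro ⟨r1, r2, -⟩
      rcases Nat.eq_zero_or_pos c with h0 | h0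
      · exact r1 (hup h0)
      · exact not_sync_succ h.sync h0 hc r2
    refine .step (by rw [h.r11]; exact one_ne_zero)
      ((wp_body_descend hx hn hb hC.toAmort h hr heq).mono ?_)
    rintro t e σ₀ ⟨rfl, q1, q2, q3⟩
    refine ⟨s - a (k + 1), ?_, by linarith [hC.le (k + 1)], by push_cast; linarith⟩
    refine blk 0 (by omega) 0 rep σ₀ _ (fun _ => rfl) (by simpa using q1) (by linarith) ?_
    intro rep₁ σ₁ c₁ l₁
    refine blk 1 (by omega) 1 rep₁ σ₁ _ (by omega) c₁ (by linarith) ?_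
    intro rep₂ σ₂ c₂ l₂
    refine blk 2 (by omega) 1 rep₂ σ₂ _ (by omega) c₂ (by linarith) ?_
    intro rep₃ σ₃ c₃ l₃
    refine blk 3 (by omega) 1 rep₃ σ₃ _ (by omega) c₃ (by linarith) ?_
    intro rep₄ σ₄ c₄ l₄
    have hd : d + (3 + 1) * 4 ^ k = d + 4 ^ (k + 1) := by rw [pow_succ']
    rw [hd] at c₄
    have hl : ∀ c ∈ elems n, k < level n c → rep₄ c = rep c := fun c hc hlc => by
      rw [l₄ c hc hlc, l₃ c hc hlc, l₂ c hc hlc, l₁ c hc hlc]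
    have hg := hC.gain_succ k
    have hrise : CanRise i j k (d + 4 ^ (k + 1)) 1 := by
      refine ⟨one_ne_zero, ?_, by omega⟩
      have := sync_add (c := 1) (i := i) (j := j) (k := k + 1) (d := d)
      rw [one_mul] at this
      exact this.2 h.sync
    refine .step (by rw [c₄.r11]; exact one_ne_zero)
      ((wp_body_rise hx hn hb hC.toAmort c₄ hrise (by linarith [hC.pos (k + 1)])).mono ?_)
    rintro t e σ₅ ⟨rfl, rep₅, p1, -, p2, p3, p4⟩
    rw [Nat.add_sub_cancel] at p2
    have hi : i + d ≤ n := hx ▸ h.ext.1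
    have hj : j + d ≤ n := hx ▸ h.ext.2.1
    obtain ⟨m1, m2⟩ := sync_mem_elems h.sync h.pow_le hi hj
    rw [hl _ m1 (by rw [level_addr hi]; omega), hl _ m2 (by rw [level_addr hj]; omega)] at p2
    have p2 := p2 heq
    -- The gain refunds the four sub-blocks and pays for this rise; only the charge `a (k + 1)` for
    -- the descent remains.
    refine ⟨s - a (k + 1), hQ rep₅ σ₅ p1 ?_, by linarith [hC.le (k + 1)], by push_cast; linarith⟩
    intro c hc hlc
    rw [p4 c hc (by omega), hl c hc (by omega)]

/-- The amortized cost of a query after level `k` has been reached. -/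
def restCost (a : ℕ → ℝ) (L k : ℕ) : ℝ := failCost a L + 8 * ∑ l ∈ Finset.Ico (k + 1) (L + 1), a l

theorem failCost_mono (ha : ∀ k, 0 ≤ a k) : Monotone (failCost a) :=
  monotone_nat_of_le_succ fun k => by
    rw [failCost_succ]; linarith [ha (k + 1), ha k]

/-- `c` counts the blocks of level `k` before a rise is certain. Each either exposes the mismatch or
advances `d`; an earlier rise only helps. The outer induction is on the levels left. The factor 8 in
`restCost` is one rise and at most seven blocks per level. -/
theorem Finishes.climb (hx : x.length = n) (hn : 1 ≤ n) (hb : 16 * n ^ 2 ≤ 2 ^ b) (hij : i ≠ j)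
    (hC : Costs n ρ χ g β R a) (f : ℕ) : ∀ k, k + f = Nat.log 4 n → ∀ c < 8,
    ∀ (d up : ℕ) (rep : ℕ → ℕ) (σ : State) (s : ℝ), Cfg x n i j k d up rep σ →
    Sync i j (k + 1) (d + c * 4 ^ k) → 4 ^ (k + 1) ≤ d + c * 4 ^ k → (c = 0 → up ≠ 0) →
    c * a k + restCost a (Nat.log 4 n) k ≤ s → Finishes x b n i j ρ χ σ s := by
  have ha0 : ∀ k, 0 ≤ a k := fun k => by linarith [hC.pos k]
  have low : ∀ k, k ≤ Nat.log 4 n → failCost a k ≤ restCost a (Nat.log 4 n) k := by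
    intro k hk
    have h1 := failCost_mono ha0 hk
    have h2 : 0 ≤ ∑ l ∈ Finset.Ico (k + 1) (Nat.log 4 n + 1), a l :=
      Finset.sum_nonneg fun l _ => ha0 l
    unfold restCost
    linarith
  induction f with
  | zero =>
    intro k hk c
    induction c with
    | zero =>
      intro _ d up rep σ s h hs hd hup _
      -- A rise from the top level would need `4 ^ (k + 1) ≤ d ≤ n`.
      exfalso
      have h1 : i + d ≤ n := hx ▸ h.ext.1
      have h2 := Nat.le_log_of_pow_le (b := 4) (by norm_num) (show 4 ^ (k + 1) ≤ n by omega)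
      omega
    | succ c ihc =>
      intro hc d up rep σ s h hs hd hup hcost
      push_cast at hcost
      have hak := ha0 k
      have hc0 : 0 ≤ (c : ℝ) * a k := by positivity
      have hnr : ¬ CanRise i j k d up := by
        rintro ⟨-, -, h3⟩
        have h1 : i + d ≤ n := hx ▸ h.ext.1
        have h2 := Nat.le_log_of_pow_le (b := 4) (by norm_num) (show 4 ^ (k + 1) ≤ n by omega)
        omega
      refine .block hx hn hb hij hC k d up rep σ s h hnr (by linarith [low k (by omega)]) ?_
      intro rep' σ' h' _
      have he : d + 4 ^ k + c * 4 ^ k = d + (c + 1) * 4 ^ k := by ring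
      exact ihc (by omega) _ _ _ _ _ h' (he ▸ hs) (he ▸ hd) (fun _ => one_ne_zero) (by linarith)
  | succ f ih =>
    intro k hk c
    have rise : ∀ (d up : ℕ) (rep : ℕ → ℕ) (σ : State) (s : ℝ), Cfg x n i j k d up rep σ →
        CanRise i j k d up → restCost a (Nat.log 4 n) k ≤ s → Finishes x b n i j ρ χ σ s := by
      intro d up rep σ s h hr hcost
      refine .step (by rw [h.r11]; exact one_ne_zero)
        ((wp_body_rise hx hn hb hC.toAmort h hr
          (by linarith [hC.gain_succ k, ha0 k, ha0 (k + 1)])).mono ?_)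
      rintro t e σ' ⟨rfl, rep', h1, h2, -, h3, -⟩
      refine ⟨s - a (k + 1), ?_, by linarith [hC.le (k + 1)], by push_cast; linarith⟩
      obtain ⟨c, c1, c2, c3⟩ := exists_sync_succ h1.sync
      refine ih (k + 1) (by omega) c c2 d up rep' σ' _ h1 c3 ?_ (by omega) ?_
      · have : 4 * 4 ^ (k + 1) ≤ c * 4 ^ (k + 1) := Nat.mul_le_mul_right _ c1
        rw [pow_succ']; omega
      · have hc7 : (c : ℝ) ≤ 7 := by exact_mod_cast (by omega : c ≤ 7)
        have := mul_le_mul_of_nonneg_right hc7 (ha0 (k + 1))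
        unfold restCost at hcost ⊢
        rw [Finset.sum_eq_sum_Ico_succ_bot (by omega)] at hcost
        linarith
    induction c with
    | zero =>
      intro _ d up rep σ s h hs hd hup hcost
      refine rise d up rep σ s h ⟨hup rfl, by simpa using hs, by simpa using hd⟩ ?_
      simpa using hcost
    | succ c ihc =>
      intro hc d up rep σ s h hs hd hup hcost
      push_cast at hcost
      have hak := ha0 k
      have hc0 : 0 ≤ (c : ℝ) * a k := by positivity
      by_cases hr : CanRise i j k d up
      · exact rise d up rep σ s h hr (by linarith)
      refine .block hx hn hb hij hC k d up rep σ s h hr (by linarith [low k (by omega)]) ?_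
      intro rep' σ' h' _
      have he : d + 4 ^ k + c * 4 ^ k = d + (c + 1) * 4 ^ k := by ring
      exact ihc (by omega) _ _ _ _ _ h' (he ▸ hs) (he ▸ hd) (fun _ => one_ne_zero) (by linarith)

theorem Finishes.query (hx : x.length = n) (hn : 1 ≤ n) (hb : 16 * n ^ 2 ≤ 2 ^ b) (hij : i ≠ j)
    (hC : Costs n ρ χ g β R a) (h : Cfg x n i j 0 0 0 rep σ) :
    Finishes x b n i j ρ χ σ (12 * ∑ l ∈ Finset.range (Nat.log 4 n + 1), a l) := by
  have ha0 : ∀ k, 0 ≤ a k := fun k => by linarith [hC.pos k]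
  obtain ⟨c, c1, c2, c3⟩ := exists_sync_succ h.sync
  refine .climb hx hn hb hij hC _ 0 (Nat.zero_add _) c c2 0 0 rep σ _ h c3 (by simp; omega)
    (by omega) ?_
  have hc7 : (c : ℝ) ≤ 7 := by exact_mod_cast (by omega : c ≤ 7)
  have h1 := mul_le_mul_of_nonneg_right hc7 (ha0 0)
  unfold restCost failCost
  rw [Finset.sum_Ico_eq_sub _ (by omega), Finset.sum_range_one, Finset.sum_range_succ _ (Nat.log 4 n)]
  have h2 := Finset.sum_nonneg fun l (_ : l ∈ Finset.range (Nat.log 4 n)) => ha0 l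
  linarith [ha0 0, ha0 (Nat.log 4 n)]

/-! ### Query and preprocessing programs. -/

/-- The program that answers a query. -/
def queryProg : Prog :=
  .seq (.op .eq 19 0 1) <| .ite 19 (.op .sub 0 2 0)
    (.seq (.const 7 0) <| .seq (.const 8 1) <| .seq (.op .add 9 3 20) <| .seq (.const 10 0) <|
      .seq (.const 11 1) <| .seq (.loop 11 bodyProg) (.op .add 0 7 20))

/-- The preprocessing sets some registers. -/
def prepProg : Prog :=
  .seq (.const 4 1) <| .seq (.const 5 2) <| .seq (.const 6 4) <| .seq (.op .add 2 0 20) <|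
    .seq (.op .add 3 2 4) (.op .mul 3 3 5)

theorem wp_query (hx : x.length = n) (hn : 1 ≤ n) (hb : 16 * n ^ 2 ≤ 2 ^ b)
    (hC : Costs n ρ χ g β R a) (hc : Consts n σ) (hB : Blocks x n σ.mem rep)
    (hi : i < n) (hj : j < n) (h0 : σ.reg 0 = i) (h1 : σ.reg 1 = j) :
    wp x b queryProg σ fun t e σ' => Consts n σ' ∧ (∃ rep, Blocks x n σ'.mem rep) ∧
      σ'.reg 0 = lce x i j ∧
      t + timePot n ρ χ σ' ≤ timePot n ρ χ σ + 12 * ∑ l ∈ Finset.range (Nat.log 4 n + 1), a l + 8 ∧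
      e + rootCount n σ'.mem ≤ rootCount n σ.mem + 1 := by
  have h1b : 1 < 2 ^ b := by nlinarith
  have h0b : 0 < 2 ^ b := by positivity
  have hsum : 0 ≤ ∑ l ∈ Finset.range (Nat.log 4 n + 1), a l :=
    Finset.sum_nonneg fun l _ => by linarith [hC.pos l]
  obtain ⟨c2, c3, c4, c5, c6, c20⟩ := hc
  unfold queryProg
  by_cases hij : i = j
  · simp only [wp_seq, wp_op, wp_ite, Op.eval, h0, h1, if_pos hij, Nat.mod_eq_of_lt h1b,
      State.setReg_reg, Nat.reduceEqDiff, if_true, if_false, one_ne_zero, c2]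
    have hm : (n - i) % 2 ^ b = n - i := Nat.mod_eq_of_lt (by nlinarith [Nat.sub_le n i])
    refine ⟨⟨?_, ?_, ?_, ?_, ?_, ?_⟩, ⟨rep, hB⟩, ?_, ?_, ?_⟩
    any_goals simp only [State.setReg_reg, Nat.reduceEqDiff, if_false] <;> assumption
    · rw [hm]
      subst hij
      exact (lce_eq ⟨by omega, by omega, fun _ _ => rfl⟩ fun h => by have := h.1; omega).symm
    · unfold timePot
      simp only [State.setReg_mem]
      push_cast; linarith
    · simp only [State.setReg_mem]
      push_cast; linarith
  · simp only [wp_seq, wp_op, wp_ite, wp_const, Op.eval, h0, h1, if_neg hij, Nat.zero_mod,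
      Nat.mod_eq_of_lt h1b, State.setReg_reg, Nat.reduceEqDiff, if_true, if_false, c3, c20]
    have hm : (2 * (n + 1) + 0) % 2 ^ b = 2 * (n + 1) := Nat.mod_eq_of_lt (by nlinarith)
    rw [hm]
    refine wp.mono (Finishes.query (rep := rep) (i := i) (j := j) hx hn hb hij hC ?_) ?_
    · refine ⟨⟨⟨?_, ?_, ?_, ?_, ?_, ?_⟩, ?_, ?_, ?_, ?_, ?_, ?_, ?_⟩, hB, sync_zero i j 0,
        ⟨by omega, by omega, by omega⟩, by simpa using hn, Nat.zero_le _⟩ <;>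
        simp [*]
    · rintro t e σ' ⟨q1, q2, q3, q4, q5⟩
      have hl : lce x i j < 2 ^ b := by
        have := (isGreatest_lce x (i := i) (j := j) (by omega) (by omega)).1.1
        rw [hx] at this
        nlinarith
      refine ⟨?_, q2, ?_, ?_, ?_⟩
      · obtain ⟨c2, c3, c4, c5, c6, c20⟩ := q1
        refine ⟨?_, ?_, ?_, ?_, ?_, ?_⟩ <;> simpa
      · rw [q3, q1.r20]
        simp [Nat.mod_eq_of_lt hl]
      · unfold timePot at q4 ⊢
        simp only [State.setReg_mem] at q4 ⊢
        push_cast; linarith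
      · simp only [State.setReg_mem] at q5 ⊢
        push_cast; linarith

theorem wp_prep (hn : 1 ≤ n) (hb : 16 * n ^ 2 ≤ 2 ^ b) :
    wp x b prepProg (State.init n) fun t e σ' => t = 6 ∧ e = 0 ∧ Consts n σ' ∧
      σ'.mem = fun _ => 0 := by
  have e1 : 1 % 2 ^ b = 1 := Nat.mod_eq_of_lt (by nlinarith)
  have e2 : 2 % 2 ^ b = 2 := Nat.mod_eq_of_lt (by nlinarith)
  have e4 : 4 % 2 ^ b = 4 := Nat.mod_eq_of_lt (by nlinarith)
  have en : n % 2 ^ b = n := Nat.mod_eq_of_lt (by nlinarith)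
  have en1 : (n + 1) % 2 ^ b = n + 1 := Nat.mod_eq_of_lt (by nlinarith)
  have es : (n + 1) * 2 % 2 ^ b = (n + 1) * 2 := Nat.mod_eq_of_lt (by nlinarith)
  unfold prepProg State.init
  simp only [wp_seq, wp_op, wp_const, Op.eval, State.setReg_reg, Nat.reduceEqDiff, if_true,
    if_false, e1, e2, e4, en, Nat.add_zero, en1, es, State.setReg_mem]
  refine ⟨trivial, trivial, ⟨?_, ?_, ?_, ?_, ?_, ?_⟩, trivial⟩ <;>
    simp only [State.setReg_reg, Nat.reduceEqDiff, if_true, if_false]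
  ring

end LCE

namespace LCE

/-! Buckets, the iterated logarithm, and the total cost. -/

/-- Towers of powers of two. -/
def tower : ℕ → ℕ
  | 0 => 1
  | k + 1 => 2 ^ tower k

theorem tower_lt_succ (k : ℕ) : tower k < tower (k + 1) := Nat.lt_two_pow_self

theorem lt_tower (k : ℕ) : k < tower k := by
  induction k with
  | zero => exact Nat.one_pos
  | succ k ih => have := tower_lt_succ k; omega

theorem tower_mono : Monotone tower := monotone_nat_of_le_succ fun k => (tower_lt_succ k).le

theorem le_tower_of_iterate (k : ℕ) : ∀ y : ℝ, (Real.logb 2)^[k] y ≤ 1 → y ≤ tower k := by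
  induction k with
  | zero => intro y h; simpa [tower] using h
  | succ k ih =>
    intro y h
    rw [Function.iterate_succ_apply] at h
    have h1 := ih _ h
    rcases le_or_gt y 0 with h0 | h0
    · exact h0.trans (by positivity)
    · rw [Real.logb_le_iff_le_rpow (by norm_num) h0, Real.rpow_natCast] at h1
      simpa [tower] using h1

/-- Only some `l ≤ k` is claimed: `Real.logb` of a negative number is the logarithm of its absolute
value, so iterating further can exceed 1 again. -/
theorem exists_iterate_of_le_tower (k : ℕ) :
    ∀ y : ℝ, y ≤ tower k → ∃ l ≤ k, (Real.logb 2)^[l] y ≤ 1 := by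
  induction k with
  | zero => intro y h; exact ⟨0, le_rfl, by simpa [tower] using h⟩
  | succ k ih =>
    intro y h
    rcases le_or_gt y 1 with h0 | h0
    · exact ⟨0, Nat.zero_le _, h0⟩
    · obtain ⟨l, h1, h2⟩ := ih (Real.logb 2 y) (by
        rw [Real.logb_le_iff_le_rpow (by norm_num) (by linarith), Real.rpow_natCast]
        simpa [tower] using h)
      exact ⟨l + 1, by omega, by rwa [Function.iterate_succ_apply]⟩

theorem le_tower_logStar (n : ℕ) : n ≤ tower (logStar n) := by
  have hne : {k : ℕ | (Real.logb 2)^[k] (n : ℝ) ≤ 1}.Nonempty := by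
    obtain ⟨l, -, h⟩ := exists_iterate_of_le_tower n n (by exact_mod_cast (lt_tower n).le)
    exact ⟨l, h⟩
  have := le_tower_of_iterate _ _ (Nat.sInf_mem hne)
  exact_mod_cast this

theorem logStar_le {n k : ℕ} (h : n ≤ tower k) : logStar n ≤ k := by
  obtain ⟨l, h1, h2⟩ := exists_iterate_of_le_tower k n (by exact_mod_cast h)
  exact (Nat.sInf_le h2).trans h1

/-- The bucket of a rank. -/
def bucket (r : ℕ) : ℕ := Nat.find (⟨r, lt_tower r⟩ : ∃ j, r < tower j)

theorem lt_tower_bucket (r : ℕ) : r < tower (bucket r) :=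
  Nat.find_spec (⟨r, lt_tower r⟩ : ∃ j, r < tower j)

theorem bucket_le {r j : ℕ} (h : r < tower j) : bucket r ≤ j := Nat.find_min' _ h

theorem lt_bucket {r j : ℕ} (h : tower j ≤ r) : j < bucket r := by
  by_contra hlt
  have := tower_mono (not_lt.1 hlt)
  have := lt_tower_bucket r
  omega

theorem sum_two_pow_le (m M : ℕ) : ∑ s ∈ Finset.Ico m M, (1 : ℝ) / 2 ^ s ≤ 2 / 2 ^ m := by
  rcases le_total M m with h | h
  · rw [Finset.Ico_eq_empty_of_le h, Finset.sum_empty]; positivity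
  · have : ∑ s ∈ Finset.Ico m M, (1 : ℝ) / 2 ^ s = 2 / 2 ^ m - 2 / 2 ^ M := by
      induction M, h using Nat.le_induction with
      | base => simp
      | succ M h ih => rw [Finset.sum_Ico_succ_top h, ih, pow_succ]; field_simp; ring
    rw [this]
    have : (0 : ℝ) ≤ 2 / 2 ^ M := by positivity
    linarith

/-- On the ranks from `tower j` to `tower (j + 1) - 1` the numerator is constantly `2 ^ tower j`,
and the geometric sum leaves at most 2 per bucket. -/
theorem sum_bucket_le (j : ℕ) :
    ∑ s ∈ Finset.range (tower j), (tower (bucket s) : ℝ) / 2 ^ s ≤ 2 * j + 1 := by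
  induction j with
  | zero =>
    have : bucket 0 = 0 := Nat.le_zero.1 (bucket_le Nat.one_pos)
    simp [tower, this]
  | succ j ih =>
    rw [← Finset.sum_range_add_sum_Ico _ (tower_lt_succ j).le]
    have h1 : ∀ s ∈ Finset.Ico (tower j) (tower (j + 1)),
        (tower (bucket s) : ℝ) / 2 ^ s = tower (j + 1) * (1 / 2 ^ s) := by
      intro s hs
      obtain ⟨s1, s2⟩ := Finset.mem_Ico.1 hs
      have : bucket s = j + 1 := le_antisymm (bucket_le s2) (lt_bucket s1)
      rw [this]; ring
    rw [Finset.sum_congr rfl h1, ← Finset.mul_sum]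
    have h2 := mul_le_mul_of_nonneg_left (sum_two_pow_le (tower j) (tower (j + 1)))
      (Nat.cast_nonneg (α := ℝ) (tower (j + 1)))
    have h3 : (tower (j + 1) : ℝ) * (2 / 2 ^ tower j) = 2 := by
      simp only [tower]; push_cast; field_simp
    push_cast
    linarith

/-! ### Credits for finds and links in low and high levels. -/

/-- The bound on ranks. -/
def maxRank (n : ℕ) : ℕ := Nat.log 2 (n + 1)

/-- Levels with many blocks. -/
def IsLow (n k : ℕ) : Prop := 2 ^ k < (maxRank n + 1) ^ 2

open Classical in
/-- The end of the bucket of rank `r` in level `k`. -/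
noncomputable def bucketEnd (n k r : ℕ) : ℕ :=
  if IsLow n k then tower (bucket r) else maxRank n + 1

open Classical in
/-- The bucket of rank `r` in level `k`. -/
noncomputable def bucketIndex (n k r : ℕ) : ℕ := if IsLow n k then bucket r else 0

open Classical in
/-- The bound on the bucket index. -/
noncomputable def bucketBound (n k : ℕ) : ℕ := if IsLow n k then logStar n + 1 else 0

/-- The credit of a node whose parent has rank `s`. -/
noncomputable def nodeCredit (n k r s : ℕ) : ℝ := ((bucketEnd n k r - s : ℕ) : ℝ)

/-- The credit of a root. -/
noncomputable def rootCredit (n k r : ℕ) : ℝ :=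
  ∑ s ∈ Finset.Ico r (maxRank n + 1), (bucketEnd n k s : ℝ) * 2 ^ r / 2 ^ s

/-- The amortized cost of an iteration. -/
noncomputable def iterCost (n k : ℕ) : ℝ := 12 * bucketBound n k + 61

/-- The gain of a link. -/
noncomputable def gain (n k : ℕ) : ℝ := (iterCost n k + 4 * iterCost n (k - 1)) / 6

theorem maxRank_lt_tower (n : ℕ) : maxRank n < tower (logStar n + 1) := by
  have h1 : maxRank n < n + 1 := Nat.log_lt_self _ (by omega)
  have h2 := le_tower_logStar n
  have h3 := tower_lt_succ (logStar n)
  omega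

/-- The recurrence behind linking: two roots of equal rank can fund a root of the next rank and a
child with full credit. -/
theorem rootCredit_succ {n k r : ℕ} (h : r ≤ maxRank n) :
    2 * rootCredit n k r = 2 * bucketEnd n k r + rootCredit n k (r + 1) := by
  unfold rootCredit
  rw [Finset.sum_eq_sum_Ico_succ_bot (by omega), mul_add, Finset.mul_sum,
    mul_div_assoc (bucketEnd n k r : ℝ), div_self (by positivity), mul_one]
  congr 1
  refine Finset.sum_congr rfl fun s _ => ?_
  rw [pow_succ]; ring

theorem rootCredit_nonneg (n k r : ℕ) : 0 ≤ rootCredit n k r :=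
  Finset.sum_nonneg fun _ _ => by positivity

theorem iterCost_pos (n k : ℕ) : 61 ≤ iterCost n k := by
  unfold iterCost
  have : (0 : ℝ) ≤ bucketBound n k := by positivity
  linarith

theorem gain_nonneg (n k : ℕ) : 0 ≤ gain n k := by
  unfold gain
  linarith [iterCost_pos n k, iterCost_pos n (k - 1)]

theorem costs (n : ℕ) : Costs n (fun k r => rootCredit n k r + gain n k) (nodeCredit n) (gain n)
    (bucketIndex n) (bucketBound n) (iterCost n) where
  weights :=
    { anti := fun k r s s' h => by
        unfold nodeCredit
        exact_mod_cast Nat.sub_le_sub_left h _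
      lt := fun k r s h hs => by
        have h1 := rootCredit_succ (n := n) (k := k) (r := r) (by unfold maxRank; omega)
        have h2 := rootCredit_nonneg n k (r + 1)
        have h3 : nodeCredit n k r s ≤ bucketEnd n k r := by
          unfold nodeCredit; exact_mod_cast Nat.sub_le _ _
        linarith
      eq := fun k r hr => by
        have h1 := rootCredit_succ (n := n) (k := k) (r := r) hr
        have h3 : nodeCredit n k r (r + 1) ≤ bucketEnd n k r := by
          unfold nodeCredit; exact_mod_cast Nat.sub_le _ _
        have h4 : (0 : ℝ) ≤ bucketEnd n k r := by positivity
        linarith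
      nonneg_root := fun k r => add_nonneg (rootCredit_nonneg _ _ _) (gain_nonneg _ _)
      nonneg := fun k r s => by unfold nodeCredit; positivity }
  buckets :=
    { step := fun k r s s' h1 h2 h3 => by
        rcases lt_or_ge s (bucketEnd n k r) with h | h
        · left
          unfold nodeCredit
          exact_mod_cast (by omega : bucketEnd n k r - s' + 1 ≤ bucketEnd n k r - s)
        -- The old parent has left the bucket of the node, so the new one lies in a later bucket. In
        -- high levels the single bucket contains all ranks and this case is void.
        · right
          unfold bucketEnd at h
          unfold bucketIndex
          split_ifs at h ⊢
          · exact lt_bucket (h.trans h2.le)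
          · unfold maxRank at h; omega
      mono := fun k r s h => by
        unfold bucketIndex
        split_ifs
        · exact bucket_le (h.trans_lt (lt_tower_bucket s))
        · rfl
      le := fun k r hr => by
        unfold bucketIndex bucketBound
        split_ifs
        · exact bucket_le (lt_of_le_of_lt hr (maxRank_lt_tower n))
        · rfl }
  le := fun k => le_rfl
  gain_zero := by
    unfold gain
    simp only [Nat.zero_sub]
    linarith [iterCost_pos n 0]
  gain_succ := fun k => by
    unfold gain
    rw [Nat.add_sub_cancel]
    linarith

/-! ### Initial potentials and sums over levels. -/

theorem pot_zero (n : ℕ) (ρ : ℕ → ℕ → ℝ) (χ : ℕ → ℕ → ℕ → ℝ) :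
    pot (elems n) (level n) ρ χ (fun _ => 0) =
      ∑ k ∈ Finset.range (Nat.log 4 n + 1), ((levelSet n k).card : ℝ) * ρ k 0 := by
  unfold pot
  simp only [if_true]
  rw [pot_elems n fun k _ => ρ k 0]
  simp

theorem card_levelSet_le (n k : ℕ) : (levelSet n k).card ≤ n + 1 := by
  classical
  unfold levelSet
  exact (Finset.card_filter_le _ _).trans (by simp)

theorem blocks_zero {A : Type*} (x : List A) (n : ℕ) : Blocks x n (fun _ => 0) id where
  forest :=
    { even := fun a ha => by
        obtain ⟨k, -, v, -, -, rfl⟩ := mem_elems.1 ha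
        exact addr_even n k v
      par := fun a _ h => absurd rfl h
      root := fun _ _ _ => rfl
      rep := fun a ha => ⟨ha, rfl, rfl, le_rfl⟩
      sum_rank := fun k => by
        rw [pot_zero]
        unfold rankWeight
        simp only [pow_zero, mul_ite, mul_one, mul_zero, Finset.sum_ite_eq']
        have : ((levelSet n k).card : ℝ) ≤ ((n + 1 : ℕ) : ℝ) := by
          exact_mod_cast card_levelSet_le n k
        split_ifs
        · exact this
        · positivity }
  same := fun l u v _ _ _ _ h => Or.inl (addr_inj.1 h)

theorem rootCount_zero (n : ℕ) : rootCount n (fun _ => 0) ≤ n + 1 := by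
  unfold rootCount
  rw [pot_zero]
  simp only [mul_ite, mul_one, mul_zero, Finset.sum_ite_eq']
  have : ((levelSet n 0).card : ℝ) ≤ ((n + 1 : ℕ) : ℝ) := by
    exact_mod_cast card_levelSet_le n 0
  push_cast at this
  split_ifs
  · exact this
  · positivity

/-- The last term bounds the high levels, where the fraction is at least 1; its factor `2 ^ k` is
there to cancel against the number of blocks. -/
theorem rootCredit_zero_le (n k : ℕ) : rootCredit n k 0 ≤ 2 * logStar n + 3 +
    2 * (maxRank n + 1) * (2 ^ k / (maxRank n + 1) ^ 2) := by
  have h0 : (0 : ℝ) ≤ 2 * (maxRank n + 1) * (2 ^ k / (maxRank n + 1) ^ 2) := by positivity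
  unfold rootCredit bucketEnd
  simp only [pow_zero, mul_one]
  split_ifs with hl
  · have h1 := sum_bucket_le (logStar n + 1)
    have h2 : ∑ s ∈ Finset.Ico 0 (maxRank n + 1), (tower (bucket s) : ℝ) / 2 ^ s ≤
        ∑ s ∈ Finset.range (tower (logStar n + 1)), (tower (bucket s) : ℝ) / 2 ^ s := by
      refine Finset.sum_le_sum_of_subset_of_nonneg ?_ fun _ _ _ => by positivity
      intro s hs
      have := maxRank_lt_tower n
      simp only [Finset.mem_Ico, Finset.mem_range] at hs ⊢
      omega
    push_cast at h1
    linarith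
  · have h1 : ∑ s ∈ Finset.Ico 0 (maxRank n + 1), ((maxRank n + 1 : ℕ) : ℝ) / 2 ^ s =
        ((maxRank n + 1 : ℕ) : ℝ) * ∑ s ∈ Finset.Ico 0 (maxRank n + 1), (1 : ℝ) / 2 ^ s := by
      rw [Finset.mul_sum]
      exact Finset.sum_congr rfl fun s _ => by ring
    rw [h1]
    have h2 := mul_le_mul_of_nonneg_left (sum_two_pow_le 0 (maxRank n + 1))
      (Nat.cast_nonneg (α := ℝ) (maxRank n + 1))
    have h3 : (1 : ℝ) ≤ 2 ^ k / (maxRank n + 1) ^ 2 := by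
      rw [le_div_iff₀ (by positivity), one_mul]
      exact_mod_cast not_lt.1 hl
    have h4 := mul_le_mul_of_nonneg_left h3 (by positivity : (0 : ℝ) ≤ 2 * (maxRank n + 1))
    have h5 : (0 : ℝ) ≤ logStar n := by positivity
    push_cast at h2 ⊢
    linarith

theorem iterCost_le (n k : ℕ) : iterCost n k ≤ 12 * logStar n + 73 := by
  unfold iterCost bucketBound
  have : (0 : ℝ) ≤ logStar n := by positivity
  split_ifs <;> push_cast <;> linarith

/-- Per level, the log* part decays geometrically, and the rest is at most `8 * n / (maxRank n + 1)`
on at most `maxRank n + 1` levels. -/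
theorem timePot_zero_le {n : ℕ} (hn : 1 ≤ n) :
    pot (elems n) (level n) (fun k r => rootCredit n k r + gain n k) (nodeCredit n) (fun _ => 0) ≤
      600 * (n * (1 + logStar n)) := by
  rw [pot_zero]
  have hs0 : (0 : ℝ) ≤ logStar n := by positivity
  have hterm : ∀ k ∈ Finset.range (Nat.log 4 n + 1),
      ((levelSet n k).card : ℝ) * (rootCredit n k 0 + gain n k) ≤
        260 * (n * (1 + logStar n)) * (1 / 2 ^ k) + 8 * n / (maxRank n + 1) := by
    intro k hk
    have hk := Nat.lt_succ_iff.1 (Finset.mem_range.1 hk)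
    have hpow : 4 ^ k ≤ n := Nat.pow_le_of_le_log (by omega) hk
    have hc : ((levelSet n k).card : ℝ) * 2 ^ k ≤ 4 * n := by
      exact_mod_cast card_levelSet hpow
    have hg : gain n k ≤ 10 * logStar n + 61 := by
      unfold gain; linarith [iterCost_le n k, iterCost_le n (k - 1)]
    have h1 : rootCredit n k 0 + gain n k ≤ 65 * (1 + logStar n) +
        2 * (maxRank n + 1) * (2 ^ k / (maxRank n + 1) ^ 2) := by
      linarith [rootCredit_zero_le n k]
    refine (mul_le_mul_of_nonneg_left h1 (by positivity)).trans ?_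
    have hc' : ((levelSet n k).card : ℝ) ≤ 4 * n * (1 / 2 ^ k) := by
      rw [mul_one_div, le_div_iff₀ (by positivity)]; exact hc
    have h2 : (2 : ℝ) * (maxRank n + 1) * (2 ^ k / (maxRank n + 1) ^ 2) =
        2 * 2 ^ k / (maxRank n + 1) := by field_simp
    rw [h2, mul_add]
    have h3 := mul_le_mul_of_nonneg_right hc' (by positivity : (0 : ℝ) ≤ 65 * (1 + logStar n))
    have h4 := mul_le_mul_of_nonneg_right hc'
      (by positivity : (0 : ℝ) ≤ 2 * 2 ^ k / (maxRank n + 1))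
    have h5 : (4 : ℝ) * n * (1 / 2 ^ k) * (2 * 2 ^ k / (maxRank n + 1)) =
        8 * n / (maxRank n + 1) := by field_simp; ring
    linarith
  refine (Finset.sum_le_sum hterm).trans ?_
  rw [Finset.sum_add_distrib, ← Finset.mul_sum, Finset.sum_const, Finset.card_range, nsmul_eq_mul]
  have h1 := sum_two_pow_le 0 (Nat.log 4 n + 1)
  rw [← Finset.range_eq_Ico] at h1
  have h2 : Nat.log 4 n ≤ maxRank n :=
    (Nat.log_anti_left (by norm_num) (by norm_num)).trans (Nat.log_mono_right (by omega))
  have h3 : ((Nat.log 4 n + 1 : ℕ) : ℝ) * (8 * n / (maxRank n + 1)) ≤ 8 * n := by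
    rw [mul_div_assoc', div_le_iff₀ (by positivity)]
    have : ((Nat.log 4 n + 1 : ℕ) : ℝ) ≤ maxRank n + 1 := by exact_mod_cast Nat.succ_le_succ h2
    nlinarith [Nat.cast_nonneg (α := ℝ) n]
  have h4 := mul_le_mul_of_nonneg_left h1
    (by positivity : (0 : ℝ) ≤ 260 * (n * (1 + logStar n)))
  have h5 : (n : ℝ) ≤ n * (1 + logStar n) := by nlinarith [Nat.cast_nonneg (α := ℝ) n]
  simp only [pow_zero, div_one] at h4
  linarith

theorem mul_le_two_pow (l : ℕ) : (l + 3) * (2 * l + 2) ≤ 8 * 2 ^ l := by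
  -- The inductive step is too weak from 0 to 1, so the induction starts at 1.
  match l with
  | 0 => norm_num
  | l + 1 =>
    induction l with
    | zero => norm_num
    | succ l ih => rw [pow_succ]; nlinarith

theorem logStar_le_log (n : ℕ) : logStar n ≤ Nat.log 2 (maxRank n + 1) + 2 := by
  refine logStar_le ?_
  have h1 : n + 1 < 2 ^ (maxRank n + 1) := Nat.lt_pow_succ_log_self (by norm_num) _
  have h2 : maxRank n + 1 < 2 ^ (Nat.log 2 (maxRank n + 1) + 1) :=
    Nat.lt_pow_succ_log_self (by norm_num) _
  have h3 := lt_tower (Nat.log 2 (maxRank n + 1))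
  have h4 : maxRank n + 1 ≤ 2 ^ tower (Nat.log 2 (maxRank n + 1)) :=
    h2.le.trans (Nat.pow_le_pow_right (by norm_num) h3)
  have h5 : 2 ^ (maxRank n + 1) ≤ 2 ^ 2 ^ tower (Nat.log 2 (maxRank n + 1)) :=
    Nat.pow_le_pow_right (by norm_num) h4
  simp only [tower]
  omega

/-- With `l` about log log n there are at most `2 * l + 2` low levels, each with bound at most `l +
3`; their product is O(log n). -/
theorem sum_iterCost_le (n : ℕ) :
    ∑ k ∈ Finset.range (Nat.log 4 n + 1), iterCost n k ≤ 157 * (maxRank n + 1) := by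
  classical
  unfold iterCost
  rw [Finset.sum_add_distrib, ← Finset.mul_sum, Finset.sum_const, Finset.card_range, nsmul_eq_mul]
  set l := Nat.log 2 (maxRank n + 1) with hl
  have h2 : Nat.log 4 n ≤ maxRank n :=
    (Nat.log_anti_left (by norm_num) (by norm_num)).trans (Nat.log_mono_right (by omega))
  have h1 : ((Nat.log 4 n + 1 : ℕ) : ℝ) ≤ maxRank n + 1 := by exact_mod_cast Nat.succ_le_succ h2
  have h3 : ∑ k ∈ Finset.range (Nat.log 4 n + 1), bucketBound n k ≤ 8 * (maxRank n + 1) := by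
    have h4 : ∀ k ∈ Finset.range (Nat.log 4 n + 1), bucketBound n k =
        if IsLow n k then logStar n + 1 else 0 := fun k _ => rfl
    rw [Finset.sum_congr rfl h4, ← Finset.sum_filter, Finset.sum_const, smul_eq_mul]
    have h5 : ((Finset.range (Nat.log 4 n + 1)).filter fun k => IsLow n k) ⊆
        Finset.range (2 * l + 2) := by
      intro k hk
      have hk := (Finset.mem_filter.1 hk).2
      have h6 : maxRank n + 1 < 2 ^ (l + 1) := Nat.lt_pow_succ_log_self (by norm_num) _
      have h7 : 2 ^ k < 2 ^ (2 * l + 2) := by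
        refine lt_of_lt_of_le hk ?_
        rw [show 2 * l + 2 = (l + 1) * 2 by ring, pow_mul]
        exact Nat.pow_le_pow_left h6.le 2
      exact Finset.mem_range.2 ((Nat.pow_lt_pow_iff_right (by norm_num)).1 h7)
    have h8 := Finset.card_le_card h5
    rw [Finset.card_range] at h8
    have h9 := logStar_le_log n
    have h10 : 2 ^ l ≤ maxRank n + 1 := Nat.pow_log_le_self _ (by omega)
    calc _ ≤ (2 * l + 2) * (l + 3) := Nat.mul_le_mul h8 (by omega)
      _ = (l + 3) * (2 * l + 2) := Nat.mul_comm _ _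
      _ ≤ 8 * 2 ^ l := mul_le_two_pow l
      _ ≤ _ := Nat.mul_le_mul_left _ h10
  have h3' : ∑ k ∈ Finset.range (Nat.log 4 n + 1), (bucketBound n k : ℝ) ≤
      8 * (maxRank n + 1) := by exact_mod_cast h3
  linarith

theorem maxRank_le {n : ℕ} (hn : 1 ≤ n) : (maxRank n : ℝ) ≤ 1 + Real.logb 2 n := by
  have h1 : maxRank n ≤ Nat.log 2 n + 1 := by
    rw [← Nat.log_mul_base (by norm_num) (by omega)]
    exact Nat.log_mono_right (by omega)
  have h2 : ((maxRank n : ℕ) : ℝ) ≤ Nat.log 2 n + 1 := by exact_mod_cast h1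
  have h3 := Real.natLog_le_logb n 2
  push_cast at h3
  linarith

theorem exists_answers {A : Type*} {x : List A} {n b : ℕ} (hx : x.length = n) (hn : 1 ≤ n)
    (hb : 16 * n ^ 2 ≤ 2 ^ b) {ρ : ℕ → ℕ → ℝ} {χ : ℕ → ℕ → ℕ → ℝ} {g : ℕ → ℝ} {β : ℕ → ℕ → ℕ}
    {R : ℕ → ℕ} {a : ℕ → ℝ} (hC : Costs n ρ χ g β R a) (qs : List (ℕ × ℕ))
    (hq : ∀ p ∈ qs, p.1 < n ∧ p.2 < n) : ∀ (σ : State) (rep : ℕ → ℕ), Consts n σ →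
    Blocks x n σ.mem rep →
    ∃ t e, Answers x b queryProg σ qs (qs.map fun p => lce x p.1 p.2) t e ∧
      (t : ℝ) ≤ timePot n ρ χ σ +
        qs.length * (12 * ∑ l ∈ Finset.range (Nat.log 4 n + 1), a l + 8) ∧
      (e : ℝ) ≤ rootCount n σ.mem + qs.length := by
  induction qs with
  | nil =>
    intro σ rep _ _
    refine ⟨0, 0, .nil σ, ?_, ?_⟩
    · have : 0 ≤ pot (elems n) (level n) ρ χ σ.mem := hC.weights.pot_nonneg
      unfold timePot
      simp only [List.length_nil, Nat.cast_zero, zero_mul]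
      linarith
    · have : 0 ≤ rootCount n σ.mem := (weights_rootCount 0).pot_nonneg
      simp only [List.length_nil, Nat.cast_zero]
      linarith
  | cons p qs ih =>
    intro σ rep hc hB
    obtain ⟨i, j⟩ := p
    obtain ⟨hi, hj⟩ := hq (i, j) List.mem_cons_self
    obtain ⟨t, e, σ', h1, h2, ⟨rep', h3⟩, h4, h5, h6⟩ :=
      wp_query (b := b) (i := i) (j := j) (σ := (σ.setReg 0 i).setReg 1 j) (rep := rep) hx hn hb hC
        (by obtain ⟨c2, c3, c4, c5, c6, c20⟩ := hc; constructor <;> simpa) hB hi hj (by simp)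
        (by simp)
    obtain ⟨t', e', q1, q2, q3⟩ := ih (fun p hp => hq p (List.mem_cons_of_mem _ hp)) σ' rep' h2 h3
    refine ⟨t + t', e + e', ?_, ?_, ?_⟩
    · rw [List.map_cons]
      have := Answers.cons h1 q1
      rwa [h4] at this
    · have e1 : timePot n ρ χ ((σ.setReg 0 i).setReg 1 j) = timePot n ρ χ σ := rfl
      rw [e1] at h5
      rw [List.length_cons]
      push_cast
      linarith
    · simp only [State.setReg_mem] at h6
      rw [List.length_cons]
      push_cast
      linarith

end LCE

theorem mainTheorem4 :
    ∃ (prep query : LCE.Prog) (c C D : ℕ),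
      ∀ {A : Type*} (x : List A) (n b : ℕ) (qs : List (ℕ × ℕ)),
        x.length = n → 1 ≤ n → c * (Nat.log 2 n + 1) ≤ b →
        (∀ p ∈ qs, p.1 < n ∧ p.2 < n) →
        ∃ (σ : LCE.State) (time₁ tests₁ time₂ tests₂ : ℕ),
          LCE.Exec x b prep (LCE.State.init n) time₁ tests₁ σ ∧
          LCE.Answers x b query σ qs (qs.map fun p => LCE.lce x p.1 p.2) time₂ tests₂ ∧
          ((time₁ + time₂ : ℕ) : ℝ) ≤
            C * (qs.length * (1 + Real.logb 2 n) + n * (1 + (LCE.logStar n : ℝ))) ∧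
          tests₁ + tests₂ ≤ D * (n + qs.length) := by
  -- With `N = 2 ^ (Nat.log 2 n + 1)`, which is at least 2 and exceeds `n`, `N ^ 6` bounds `16 * n ^
  -- 2`, the size of the address space. The time constant covers `6 * 600 + 6` for the potential and
  -- preprocessing and `12 * 157 * 2 + 8` per query. The tests number at most `n + 1 + q`.
  refine ⟨LCE.prepProg, LCE.queryProg, 6, 4000, 2, ?_⟩
  intro A x n b qs hx hn hb hq
  have hb' : 16 * n ^ 2 ≤ 2 ^ b := by
    have h1 : n < 2 ^ (Nat.log 2 n + 1) := Nat.lt_pow_succ_log_self (by norm_num) _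
    have h2 : 2 ^ 1 ≤ 2 ^ (Nat.log 2 n + 1) := Nat.pow_le_pow_right (by norm_num) (by omega)
    have h3 := Nat.pow_le_pow_right (n := 2) (by norm_num) hb
    rw [Nat.mul_comm 6, pow_mul] at h3
    calc 16 * n ^ 2 ≤ (2 ^ (Nat.log 2 n + 1)) ^ 4 * (2 ^ (Nat.log 2 n + 1)) ^ 2 :=
          Nat.mul_le_mul (by have := Nat.pow_le_pow_left h2 4; omega) (Nat.pow_le_pow_left h1.le 2)
      _ = (2 ^ (Nat.log 2 n + 1)) ^ 6 := by ring
      _ ≤ _ := h3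
  obtain ⟨t, e, σ, h1, rfl, rfl, h2, h3⟩ := LCE.wp_prep (x := x) hn hb'
  obtain ⟨t', e', q1, q2, q3⟩ := LCE.exists_answers hx hn hb' (LCE.costs n) qs hq σ id h2
    (h3 ▸ LCE.blocks_zero x n)
  refine ⟨σ, 6, 0, t', e', h1, q1, ?_, ?_⟩
  · have p1 := LCE.timePot_zero_le hn
    unfold LCE.timePot at q2
    rw [h3] at q2
    have hlog : 0 ≤ Real.logb 2 n := Real.logb_nonneg (by norm_num) (by exact_mod_cast hn)
    have p2 : 12 * ∑ l ∈ Finset.range (Nat.log 4 n + 1), LCE.iterCost n l + 8 ≤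
        4000 * (1 + Real.logb 2 n) := by
      linarith [LCE.sum_iterCost_le n, LCE.maxRank_le hn]
    have p3 := mul_le_mul_of_nonneg_left p2 (Nat.cast_nonneg (α := ℝ) qs.length)
    have p4 : (1 : ℝ) ≤ n * (1 + LCE.logStar n) := by
      have : (1 : ℝ) ≤ n := by exact_mod_cast hn
      have : (0 : ℝ) ≤ LCE.logStar n := by positivity
      nlinarith
    push_cast
    linarith
  · rw [h3] at q3
    have : (e' : ℝ) ≤ ((n + 1 + qs.length : ℕ) : ℝ) := by
      push_cast; linarith [LCE.rootCount_zero n]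
    have : e' ≤ n + 1 + qs.length := by exact_mod_cast this
    omega
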